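/- **Setting.** Let $P$ be the law of a pair $(X,Y)\in[0,1]\times\mathbb R$, and let $(X_1,Y_1),\dots,(X_n,Y_n)$ be independent with law $P$. Let $X_{(1)}<\dots<X_{(n)}$ be the ordered covariates (almost surely distinct under the assumptions below) and $Y_{(i)}$ the response belonging to $X_{(i)}$. Let $\Lambda_n$ be the piecewise linear function on $[0,1]$ with knots $i/n$ and $$\Lambda_n(i/n)=\frac1n\sum_{j\le i}Y_{(j)},\qquad i=0,\dots,n,$$ and let $\hat\lambda_n$ be the left-hand slope of the least concave majorant of $\Lambda_n$ on $[0,1]$. The isotonic least squares estimator $\hat\mu_n$ is the nonincreasing left-continuous step function on $[0,1]$ with $\hat\mu_n(X_{(i)})=\hat\lambda_n(i/n)$ for $i=1,\dots,n$ that is constant on $[0,X_{(1)}]$ and on each $(X_{(i-1)},X_{(i)}]$, $2\le i\le n$, and equals $\hat\mu_n(X_{(n)})$ on $(X_{(n)},1]$. For a nonincreasing left-continuous $h:[0,1]\to\mathbb R$ and $a\in\mathbb R$, the generalized inverse $h^{-1}(a)$ is the greatest $t\in[0,1]$ with $h(t)\ge a$, and $0$ if there is no such $t$. Let $A_1,A_2,A_3>0$,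 and let $\mathcal F_1$ be the class of nonincreasing differentiable functions $\mu:[0,1]\to\mathbb R$ (one-sided derivatives at the end points) such that $A_1<|\mu'(t)|<A_2$ and $|\mu(t)|\le A_3$ for all $t\in[0,1]$. Let $c,C,K,\alpha>0$. For every $\mu\in\mathcal F_1$ let $P_\mu$ be a law of $(X,Y)$ such that - $Y$ is integrable and $\mathbb E(Y\mid X)=\mu(X)$ almost surely; - (R2) $X$ has a density $f$ on $[0,1]$ with $c\le f\le C$ on $[0,1]$; - (R4) with $\epsilon=Y-\mu(X)$, $\mathbb E\left(e^{\theta\epsilon}\mid X\right)\le K e^{\theta^2\alpha}$ almost surely for every $\theta\in\mathbb R$. Here $c,C,K,\alpha$ do not depend on $\mu$. Write $\mathbb E_\mu$ for the expectation when the observations have law $P_\mu$. **Corollary 4.2.** For every $p\ge1$ there exists $K_p>0$, depending only on $p,A_1,A_2,A_3,c,C,K,\alpha$, such that 1. for every fixed $a\in\mathbb R$, $$\limsup_{n\to\infty}\ \sup_{\mu\in\mathcal F_1} n^{p/3}\,\mathbb E_\mu\left(|\hat\mu_n^{-1}(a)-\mu^{-1}(a)|^p\right)\le K_p;$$ 2.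 for every fixed $t\in(0,1)$, $$\limsup_{n\to\infty}\ \sup_{\mu\in\mathcal F_1} n^{p/3}\,\mathbb E_\mu\left(|\hat\mu_n(t)-\mu(t)|^p\right)\le K_p.$$ -/

import Mathlib

open MeasureTheory Set Filter
open scoped ENNReal Topology

noncomputable section

namespace IsoReg

/-- The class of nonincreasing functions on `[0,1]` with `A₁ < |μ'(t)| < A₂` and `|μ(t)| ≤ A₃` for
all `t ∈ [0,1]` (one-sided derivatives at the end points). Only the values on `[0,1]` matter. -/
def monoClass (A₁ A₂ A₃ : ℝ) : Set (ℝ → ℝ) :=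
  {μ | AntitoneOn μ (Icc 0 1) ∧ DifferentiableOn ℝ μ (Icc 0 1) ∧
    (∀ t ∈ Icc (0 : ℝ) 1,
      A₁ < |derivWithin μ (Icc 0 1) t| ∧ |derivWithin μ (Icc 0 1) t| < A₂) ∧
    ∀ t ∈ Icc (0 : ℝ) 1, |μ t| ≤ A₃}

/-! ### The regression model: laws `P` of a pair `(X, Y)` on `ℝ × ℝ` -/

/-- The sigma-algebra on `ℝ × ℝ` generated by the first coordinate `X`. -/
abbrev sigmaX : MeasurableSpace (ℝ × ℝ) :=
  MeasurableSpace.comap (Prod.fst : ℝ × ℝ → ℝ) (inferInstanceAs (MeasurableSpace ℝ))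

/-- `Y` is integrable and `E(Y | X) = μ(X)` almost surely. -/
def IsRegressionFunction (μ : ℝ → ℝ) (P : Measure (ℝ × ℝ)) : Prop :=
  Integrable (fun w : ℝ × ℝ => w.2) P ∧
    P[fun w : ℝ × ℝ => w.2 | sigmaX] =ᵐ[P] fun w => μ w.1

/-- `X` takes its values in `[0,1]` and has a density `f` with `c ≤ f ≤ C` on `[0,1]`. -/
def HasBoundedDensity (c C : ℝ) (P : Measure (ℝ × ℝ)) : Prop :=
  ∃ f : ℝ → ℝ, Measurable f ∧ (∀ x ∈ Icc (0 : ℝ) 1, c ≤ f x ∧ f x ≤ C) ∧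
    P.map Prod.fst = (volume.restrict (Icc (0 : ℝ) 1)).withDensity fun x => ENNReal.ofReal (f x)

/-- With `ε = Y - μ(X)`: `E(exp (θ ε) | X) ≤ K exp (θ² α)` almost surely, for every real `θ`. The
integrability of `exp (θ ε)` makes the conditional expectation meaningful. -/
def HasLightTails (μ : ℝ → ℝ) (K α : ℝ) (P : Measure (ℝ × ℝ)) : Prop :=
  ∀ θ : ℝ, Integrable (fun w : ℝ × ℝ => Real.exp (θ * (w.2 - μ w.1))) P ∧
    P[fun w : ℝ × ℝ => Real.exp (θ * (w.2 - μ w.1)) | sigmaX]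
      ≤ᵐ[P] fun _ => K * Real.exp (θ ^ 2 * α)

/-- `P` is the law of a pair `(X, Y)` that follows the regression model with regression function
`μ`, density bounds `c`, `C` and light-tail constants `K`, `α`. -/
structure IsModelLaw (c C K α : ℝ) (μ : ℝ → ℝ) (P : Measure (ℝ × ℝ)) : Prop where
  isProbabilityMeasure : IsProbabilityMeasure P
  isRegressionFunction : IsRegressionFunction μ P
  hasBoundedDensity : HasBoundedDensity c C P
  hasLightTails : HasLightTails μ K α P

/-! ### The isotonic least squares estimator based on a sample `w = ((X₁, Y₁), …, (Xₙ, Yₙ))` -/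

/-- `orderedY w j` is the response that belongs to the `j`-th smallest covariate, with `j` counted
from `0`. -/
def orderedY {n : ℕ} (w : Fin n → ℝ × ℝ) (j : Fin n) : ℝ :=
  (w (Tuple.sort (fun i => (w i).1) j)).2

/-- The cumulative sum diagram `Λₙ`: the piecewise linear function on `[0,1]` that takes the value
`(1/n) ∑_{j ≤ i} Y_(j)` at `i/n`. The `j`-th summand (`j` counted from `0`) is `0` up to `j/n`,
increases linearly to `Y_(j)` on `[j/n, (j+1)/n]` and is constant afterwards. -/
def cumSum {n : ℕ} (w : Fin n → ℝ × ℝ) (u : ℝ) : ℝ :=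
  (1 / (n : ℝ)) * ∑ j : Fin n, max 0 (min 1 ((n : ℝ) * u - (j : ℝ))) * orderedY w j

/-- The least concave majorant on `[0,1]` of a function: the pointwise infimum of the functions
that are concave on `[0,1]` and lie above it there. -/
def leastConcaveMajorant (L : ℝ → ℝ) (u : ℝ) : ℝ :=
  sInf {y : ℝ | ∃ h : ℝ → ℝ, ConcaveOn ℝ (Icc 0 1) h ∧ (∀ v ∈ Icc (0 : ℝ) 1, L v ≤ h v) ∧ y = h u}

/-- The left-hand slope at `u ∈ (0,1]` of the least concave majorant of `Λₙ`. -/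
def lambdaHat {n : ℕ} (w : Fin n → ℝ × ℝ) (u : ℝ) : ℝ :=
  derivWithin (leastConcaveMajorant (cumSum w)) (Iic u) u

/-- The isotonic least squares estimator: `muHat w X_(i) = lambdaHat w (i/n)`, and `muHat w` is
constant on `[0, X_(1)]`, on each `(X_(i-1), X_(i)]`, and (with the value at `X_(n)`) on
`(X_(n), 1]`. If exactly `k` covariates are `< t`, then `t` lies in `(X_(k), X_(k+1)]`, or in
`(X_(n), 1]` when `k = n`. -/
def muHat {n : ℕ} (w : Fin n → ℝ × ℝ) (t : ℝ) : ℝ :=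
  lambdaHat w ((min ((Finset.univ.filter fun i => (w i).1 < t).card + 1) n : ℕ) / (n : ℝ))

/-- The generalized inverse of `h : [0,1] → ℝ`: the greatest `t ∈ [0,1]` with `h t ≥ a`, and `0` if
there is no such `t` (the supremum of the empty set of reals is `0` in Mathlib). -/
def genInv (h : ℝ → ℝ) (a : ℝ) : ℝ :=
  sSup {t : ℝ | t ∈ Icc (0 : ℝ) 1 ∧ a ≤ h t}

/-! ### Risks; the `n` observations are independent with common law `P` -/

/-- `E |(muHat)⁻¹(a) - μ⁻¹(a)|^p`, as an extended nonnegative number. -/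
def inverseRisk (n : ℕ) (p a : ℝ) (μ : ℝ → ℝ) (P : Measure (ℝ × ℝ)) : ℝ≥0∞ :=
  ∫⁻ w : Fin n → ℝ × ℝ, ENNReal.ofReal (|genInv (muHat w) a - genInv μ a| ^ p)
    ∂(Measure.pi fun _ => P)

/-- `E |muHat(t) - μ(t)|^p`, as an extended nonnegative number. -/
def directRisk (n : ℕ) (p t : ℝ) (μ : ℝ → ℝ) (P : Measure (ℝ × ℝ)) : ℝ≥0∞ :=
  ∫⁻ w : Fin n → ℝ × ℝ, ENNReal.ofReal (|muHat w t - μ t| ^ p) ∂(Measure.pi fun _ => P)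

end IsoReg

end

namespace IsoReg

/-! The estimator meets a level `a` through a switching relation: for `0 < i ≤ n`, `a ≤ lambdaHat w
(i / n)` exactly when the last maximizer of `m ↦ partialSumY w m - a * m` is at least `i`
(`le_lambdaHat`, `lambdaHat_lt`). So if `a ≤ muHat w t`, there is a rank `k ≥ countLt x t` such that
every block of ordered observations ending at `k` has a nonnegative sum of `Y - a`. If moreover `μ ≤
a - y` to the right of some `s ≤ t`, the errors in the block from the first covariate `≥ s` up to
`k` sum to at least `y` times its length. The lower tail is the mirror image.

The end `k` is random, so all blocks with the same start are controlled at once. Given the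
covariates, the factors `exp (θ ε - β θ²)` are independent with mean at most one
(`integral_exp_le_of_centered`, `IsModelLaw.ae_condDistrib`), and Ville's inequality
(`maximal_inequality_prod`) bounds the conditional probability by `exp (-N y² / (4 β))`, where `N`
counts the covariates in `[s, t)`. Averaging over the design with the lower bound on the density
gives an exponent of order `n (t - s) min (1, y²)`.

For the inverse, an error `x` lets both `t - s` and `y` be of order `x`, because `μ` decreases at
rate at least `A₁`. For the estimator at a point, an error `y` allows `t - s` of order `y`, because
the rate is at most `A₂`. With `x` or `y` equal to `k n^(-1/3)`, the cubic exponent is of order `k³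
≥ k`, and summing over `k` bounds the moments uniformly in `μ`. At a point there are two further
regimes. A window that does not fit between `t` and the end points contributes a term exponentially
small in `n`, with a rate depending on `t`, which vanishes in the limit; for very large errors the
whole sample serves as the block and supplies the decay in `k`. -/

/-! ### Least concave majorants and the switching relation -/

theorem slope_leftDeriv_of_concaveOn {g : ℝ → ℝ} (hg : ConcaveOn ℝ (Icc 0 1) g) {v : ℝ}
    (hv : v ∈ Ioc (0 : ℝ) 1) {M : ℝ} (hM : ∀ u ∈ Ico 0 v, M ≤ slope g v u) :
    M ≤ derivWithin g (Iic v) v ∧ ∀ u ∈ Ico 0 v, derivWithin g (Iic v) v ≤ slope g v u := by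
  have hanti : AntitoneOn (slope g v) (Ico 0 v) := by
    have h := hg.neg.slope_mono (x := v) ⟨hv.1.le, hv.2⟩
    intro a ha b hb hab
    have := h (a := a) (b := b) ⟨⟨ha.1, ha.2.le.trans hv.2⟩, ha.2.ne⟩
      ⟨⟨hb.1, hb.2.le.trans hv.2⟩, hb.2.ne⟩ hab
    simp only [slope_neg_fun, Pi.neg_apply] at this
    linarith
  have hsub : Ioo 0 v ⊆ Ico 0 v := Ioo_subset_Ico_self
  -- The bound `M` matters at `v = 1`: a concave function may drop there, its left slope is then
  -- `-∞`, and `derivWithin` would return the default value `0`.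
  have hbdd : BddBelow (slope g v '' Ioo 0 v) := by
    refine ⟨M, ?_⟩
    rintro _ ⟨u, hu, rfl⟩
    exact hM u (hsub hu)
  have htend : Tendsto (slope g v) (𝓝[<] v) (𝓝 (sInf (slope g v '' Ioo 0 v))) :=
    (hanti.mono hsub).tendsto_nhdsWithin_Ioo_left ⟨v / 2, by linarith [hv.1], by linarith [hv.1]⟩ hbdd
  have hder : HasDerivWithinAt g (sInf (slope g v '' Ioo 0 v)) (Iic v) v := by
    rw [← hasDerivWithinAt_Iio_iff_Iic, hasDerivWithinAt_iff_tendsto_slope]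
    simpa using htend
  rw [hder.derivWithin (uniqueDiffWithinAt_Iic v)]
  constructor
  · apply le_csInf
    · exact ⟨_, v / 2, ⟨by linarith [hv.1], by linarith [hv.1]⟩, rfl⟩
    · rintro _ ⟨u, hu, rfl⟩
      exact hM u (hsub hu)
  · intro u hu
    have hu' : (u + v) / 2 ∈ Ioo 0 v := ⟨by linarith [hu.1, hu.2], by linarith [hu.2]⟩
    exact (csInf_le hbdd ⟨_, hu', rfl⟩).trans (hanti hu (hsub hu') (by linarith [hu.2]))

theorem leastConcaveMajorant_le {L h : ℝ → ℝ} (hc : ConcaveOn ℝ (Icc 0 1) h)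
    (hL : ∀ v ∈ Icc (0 : ℝ) 1, L v ≤ h v) {u : ℝ} (hu : u ∈ Icc (0 : ℝ) 1) :
    leastConcaveMajorant L u ≤ h u := by
  refine csInf_le ⟨L u, ?_⟩ ⟨h, hc, hL, rfl⟩
  rintro _ ⟨h', -, hL', rfl⟩
  exact hL' u hu

theorem le_leastConcaveMajorant_of_forall {L : ℝ → ℝ} {u y : ℝ}
    (hex : ∃ h : ℝ → ℝ, ConcaveOn ℝ (Icc 0 1) h ∧ ∀ v ∈ Icc (0 : ℝ) 1, L v ≤ h v)
    (hy : ∀ h : ℝ → ℝ, ConcaveOn ℝ (Icc 0 1) h → (∀ v ∈ Icc (0 : ℝ) 1, L v ≤ h v) → y ≤ h u) :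
    y ≤ leastConcaveMajorant L u := by
  obtain ⟨h, hc, hL⟩ := hex
  refine le_csInf ⟨_, h, hc, hL, rfl⟩ ?_
  rintro _ ⟨h', hc', hL', rfl⟩
  exact hy h' hc' hL'

theorem concaveOn_leastConcaveMajorant {L : ℝ → ℝ}
    (hex : ∃ h : ℝ → ℝ, ConcaveOn ℝ (Icc 0 1) h ∧ ∀ v ∈ Icc (0 : ℝ) 1, L v ≤ h v) :
    ConcaveOn ℝ (Icc 0 1) (leastConcaveMajorant L) := by
  refine ⟨convex_Icc 0 1, fun x hx y hy a b ha hb hab => ?_⟩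
  refine le_leastConcaveMajorant_of_forall hex fun h hc hL => ?_
  refine le_trans ?_ (hc.2 hx hy ha hb hab)
  have h1 := leastConcaveMajorant_le hc hL hx
  have h2 := leastConcaveMajorant_le hc hL hy
  simp only [smul_eq_mul]
  gcongr

/-- The sum of the first `m` ordered responses. -/
noncomputable def partialSumY {n : ℕ} (w : Fin n → ℝ × ℝ) (m : ℕ) : ℝ :=
  ∑ j : Fin n, if (j : ℕ) < m then orderedY w j else 0

theorem cumSum_eq_interpolation {n : ℕ} (w : Fin n → ℝ × ℝ) {m : ℕ} {s : ℝ} (hs : s ∈ Icc (0 : ℝ) 1)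
    {u : ℝ} (hu : (n : ℝ) * u = m + s) :
    cumSum w u = (1 - s) * (partialSumY w m / n) + s * (partialSumY w (m + 1) / n) := by
  have key : ∀ j : Fin n, max 0 (min 1 ((n : ℝ) * u - (j : ℝ))) * orderedY w j =
      (1 - s) * (if (j : ℕ) < m then orderedY w j else 0) +
        s * (if (j : ℕ) < m + 1 then orderedY w j else 0) := by
    intro j
    rw [hu]
    obtain ⟨h0, h1⟩ := hs
    rcases lt_trichotomy (j : ℕ) m with h | h | h
    · have h' : (j : ℝ) + 1 ≤ m := by exact_mod_cast h
      rw [if_pos h, if_pos (by omega), min_eq_left (by linarith), max_eq_right zero_le_one]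
      ring
    · rw [if_neg (by omega), if_pos (by omega), h, add_sub_cancel_left, min_eq_right h1,
        max_eq_right h0]
      ring
    · have h' : (m : ℝ) + 1 ≤ j := by exact_mod_cast h
      rw [if_neg (by omega), if_neg (by omega), max_eq_left (min_le_of_right_le (by linarith))]
      ring
  unfold cumSum partialSumY
  rw [Finset.sum_congr rfl fun j _ => key j, Finset.sum_add_distrib, ← Finset.mul_sum,
    ← Finset.mul_sum]
  ring

theorem cumSum_node {n : ℕ} (hn : 0 < n) (w : Fin n → ℝ × ℝ) (m : ℕ) :
    cumSum w ((m : ℝ) / n) = partialSumY w m / n := by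
  have hn' : (n : ℝ) ≠ 0 := by positivity
  rw [cumSum_eq_interpolation w (m := m) (s := 0) (by simp) (by field_simp; simp)]
  ring

theorem cumSum_le_of_concaveOn {n : ℕ} (hn : 0 < n) (w : Fin n → ℝ × ℝ) {h : ℝ → ℝ}
    (hc : ConcaveOn ℝ (Icc 0 1) h) (hh : ∀ m ≤ n, partialSumY w m / n ≤ h ((m : ℝ) / n)) :
    ∀ u ∈ Icc (0 : ℝ) 1, cumSum w u ≤ h u := by
  intro u hu
  have hn' : (0 : ℝ) < n := by positivity
  obtain ⟨m, s, hm, hs, hms⟩ : ∃ (m : ℕ) (s : ℝ), m + 1 ≤ n ∧ s ∈ Icc (0 : ℝ) 1 ∧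
      (n : ℝ) * u = m + s := by
    have h0 : 0 ≤ (n : ℝ) * u := mul_nonneg hn'.le hu.1
    rcases lt_or_ge ⌊(n : ℝ) * u⌋₊ n with h | h
    · exact ⟨⌊(n : ℝ) * u⌋₊, n * u - ⌊(n : ℝ) * u⌋₊, h,
        ⟨by linarith [Nat.floor_le h0], by linarith [Nat.lt_floor_add_one ((n : ℝ) * u)]⟩, by ring⟩
    -- Here `u = 1`, which is treated as the right end of the last cell.
    · have h1 : (n : ℝ) ≤ n * u := (Nat.le_floor_iff h0).1 h
      refine ⟨n - 1, 1, by omega, by simp, ?_⟩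
      rw [Nat.cast_sub (by omega)]
      have : (n : ℝ) * u ≤ n := by nlinarith [hu.2]
      push_cast
      linarith
  have hmem : ∀ j : ℕ, j ≤ n → (j : ℝ) / n ∈ Icc (0 : ℝ) 1 := fun j hj =>
    ⟨by positivity, (div_le_one hn').2 (by exact_mod_cast hj)⟩
  rw [cumSum_eq_interpolation w hs hms]
  have h1 := hc.2 (hmem m (by omega)) (hmem (m + 1) hm) (show 0 ≤ 1 - s by linarith [hs.2]) hs.1
    (by ring)
  have hu' : u = (1 - s) • ((m : ℝ) / n) + s • (((m + 1 : ℕ) : ℝ) / n) := by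
    have : u = (m + s) / n := by rw [← hms]; field_simp
    rw [this, smul_eq_mul, smul_eq_mul]
    push_cast
    field_simp
    ring
  rw [← hu'] at h1
  refine le_trans ?_ h1
  have h2 := hh m (by omega)
  have h3 := hh (m + 1) hm
  simp only [smul_eq_mul]
  have := hs.1
  have : 0 ≤ 1 - s := by linarith [hs.2]
  gcongr

theorem concaveOn_affine (A B : ℝ) : ConcaveOn ℝ (Icc 0 1) fun u : ℝ => A + B * u := by
  refine ⟨convex_Icc 0 1, fun x _ y _ a b _ _ hab => le_of_eq ?_⟩
  simp only [smul_eq_mul]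
  linear_combination A * hab

theorem partialSumY_le_line {n : ℕ} (hn : 0 < n) {a S T k m : ℝ} (h : S - a * m ≤ T - a * k) :
    S / n ≤ T / n + a * (m / n - k / n) := by
  have hn' : (0 : ℝ) < n := by positivity
  have : T / n + a * (m / n - k / n) = (T + a * (m - k)) / n := by field_simp
  rw [this]
  gcongr
  linarith

theorem cumSum_le_line {n : ℕ} (hn : 0 < n) (w : Fin n → ℝ × ℝ) {a : ℝ} {k : ℕ}
    (hk : ∀ m ≤ n, partialSumY w m - a * m ≤ partialSumY w k - a * k) :
    ∀ u ∈ Icc (0 : ℝ) 1, cumSum w u ≤ (partialSumY w k / n - a * (k / n)) + a * u :=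
  cumSum_le_of_concaveOn hn w (concaveOn_affine _ _) fun m hm => by
    linarith [partialSumY_le_line hn (hk m hm)]

theorem exists_concave_majorant_cumSum {n : ℕ} (hn : 0 < n) (w : Fin n → ℝ × ℝ) :
    ∃ h : ℝ → ℝ, ConcaveOn ℝ (Icc 0 1) h ∧ ∀ v ∈ Icc (0 : ℝ) 1, cumSum w v ≤ h v := by
  obtain ⟨k, -, hk⟩ := Finset.exists_max_image (Finset.range (n + 1))
    (fun m => partialSumY w m - 0 * m) ⟨0, by simp⟩
  exact ⟨_, concaveOn_affine _ _, cumSum_le_line hn w fun m hm => hk m (by simp; omega)⟩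

theorem node_mem {n : ℕ} (hn : 0 < n) {j : ℕ} (hj : j ≤ n) : (j : ℝ) / n ∈ Icc (0 : ℝ) 1 :=
  ⟨by positivity, (div_le_one (by positivity)).2 (by exact_mod_cast hj)⟩

theorem le_lcm_node {n : ℕ} (hn : 0 < n) (w : Fin n → ℝ × ℝ) {k : ℕ} (hk : k ≤ n) :
    partialSumY w k / n ≤ leastConcaveMajorant (cumSum w) ((k : ℝ) / n) := by
  rw [← cumSum_node hn]
  exact le_leastConcaveMajorant_of_forall (exists_concave_majorant_cumSum hn w)
    fun h _ hL => hL _ (node_mem hn hk)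

/-- The line of slope `a` through the node at `k/n` lies above the diagram, hence above its
majorant, and meets the majorant at `k/n`. Chords ending at `k/n` thus have slope at least `a`, and
concavity makes chords from the same left end to the earlier point `i/n` at least as steep. -/
theorem slope_lcm_ge {n : ℕ} (hn : 0 < n) (w : Fin n → ℝ × ℝ) {a : ℝ} {i k : ℕ}
    (hik : i ≤ k) (hkn : k ≤ n)
    (hk : ∀ m ≤ n, partialSumY w m - a * m ≤ partialSumY w k - a * k) :
    ∀ u ∈ Ico (0 : ℝ) ((i : ℝ) / n), a ≤ slope (leastConcaveMajorant (cumSum w)) ((i : ℝ) / n) u := by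
  intro u hu
  set G := leastConcaveMajorant (cumSum w)
  have hex := exists_concave_majorant_cumSum hn w
  have hG : ConcaveOn ℝ (Icc 0 1) G := concaveOn_leastConcaveMajorant hex
  have hin := node_mem hn (hik.trans hkn)
  have hku := node_mem hn hkn
  have hu1 : u ∈ Icc (0 : ℝ) 1 := ⟨hu.1, hu.2.le.trans hin.2⟩
  have hle : G u ≤ (partialSumY w k / n - a * (k / n)) + a * u :=
    leastConcaveMajorant_le (concaveOn_affine _ _) (cumSum_le_line hn w hk) hu1
  have hGk : partialSumY w k / n ≤ G (k / n) := le_lcm_node hn w hkn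
  have hik' : (i : ℝ) / n ≤ k / n := by gcongr
  have huk : u < k / n := hu.2.trans_le hik'
  have h1 : a ≤ slope G u (k / n) := by
    rw [slope_def_field, le_div_iff₀ (by linarith)]
    linarith
  have h2 : slope G u (k / n) ≤ slope G u (i / n) := by
    have := hG.neg.slope_mono hu1 (a := (i : ℝ) / n) (b := (k : ℝ) / n)
      ⟨hin, hu.2.ne'⟩ ⟨hku, huk.ne'⟩ hik'
    simp only [slope_neg_fun, Pi.neg_apply] at this
    linarith
  rw [slope_comm]
  exact h1.trans h2

theorem lambdaHat_bounds {n : ℕ} (hn : 0 < n) (w : Fin n → ℝ × ℝ) {i : ℕ} (hi : 0 < i)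
    (hin : i ≤ n) {M : ℝ} (hM : ∀ u ∈ Ico (0 : ℝ) ((i : ℝ) / n),
      M ≤ slope (leastConcaveMajorant (cumSum w)) ((i : ℝ) / n) u) :
    M ≤ lambdaHat w (i / n) ∧ ∀ u ∈ Ico (0 : ℝ) ((i : ℝ) / n),
      lambdaHat w (i / n) ≤ slope (leastConcaveMajorant (cumSum w)) ((i : ℝ) / n) u :=
  slope_leftDeriv_of_concaveOn (concaveOn_leastConcaveMajorant (exists_concave_majorant_cumSum hn w))
    ⟨by positivity, (node_mem hn hin).2⟩ hM

theorem le_lambdaHat {n : ℕ} (hn : 0 < n) (w : Fin n → ℝ × ℝ) {a : ℝ} {i k : ℕ} (hi : 0 < i)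
    (hik : i ≤ k) (hkn : k ≤ n)
    (hk : ∀ m ≤ n, partialSumY w m - a * m ≤ partialSumY w k - a * k) :
    a ≤ lambdaHat w (i / n) :=
  (lambdaHat_bounds hn w hi (hik.trans hkn) (slope_lcm_ge hn w hik hkn hk)).1

/-- A sufficiently negative slope puts the whole diagram under a line through its last node. This
gives the finite lower bound on chord slopes that makes every left slope of the majorant a genuine
derivative, also at `1`. -/
theorem exists_slope_maximizer_last {n : ℕ} (w : Fin n → ℝ × ℝ) :
    ∃ b : ℝ, ∀ m ≤ n, partialSumY w m - b * m ≤ partialSumY w n - b * n := by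
  obtain ⟨k, -, hk⟩ := Finset.exists_max_image (Finset.range (n + 1))
    (fun m => partialSumY w m) ⟨0, by simp⟩
  refine ⟨-|partialSumY w k - partialSumY w n|, fun m hm => ?_⟩
  have h1 := hk m (by simp; omega)
  rcases hm.eq_or_lt with rfl | hlt
  · exact le_rfl
  · have h2 : (m : ℝ) + 1 ≤ n := by exact_mod_cast hlt
    nlinarith [le_abs_self (partialSumY w k - partialSumY w n),
      abs_nonneg (partialSumY w k - partialSumY w n)]

/-- Past the last maximizer `k` all chords from node `k` to later nodes have slope below `a`; as
there are finitely many, so does their maximum `a'`. The minimum of the lines of slopes `a` and `a'`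
through node `k` is a concave majorant, so the chord of the least one from `k/n` to `i/n`, and with
it the left slope at `i/n`, is at most `a'`. -/
theorem lambdaHat_lt {n : ℕ} (hn : 0 < n) (w : Fin n → ℝ × ℝ) {a : ℝ} {i k : ℕ}
    (hki : k < i) (hin : i ≤ n)
    (hk : ∀ m ≤ n, partialSumY w m - a * m ≤ partialSumY w k - a * k)
    (hk' : ∀ m ≤ n, k < m → partialSumY w m - a * m < partialSumY w k - a * k) :
    lambdaHat w (i / n) < a := by
  have hn' : (0 : ℝ) < n := by positivity
  obtain ⟨b, hb⟩ := exists_slope_maximizer_last w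
  have hi : 0 < i := by omega
  have hslope := (lambdaHat_bounds hn w hi hin
    (slope_lcm_ge hn w hin le_rfl hb)).2 (k / n) ⟨by positivity, by gcongr⟩
  obtain ⟨m₀, hm₀, hmax⟩ := Finset.exists_max_image (Finset.Ioc k n)
    (fun m => (partialSumY w m - partialSumY w k) / ((m : ℝ) - k)) ⟨i, by simp; omega⟩
  set a' := (partialSumY w m₀ - partialSumY w k) / ((m₀ : ℝ) - k) with ha'
  have hm₀' := Finset.mem_Ioc.1 hm₀
  have ha : a' < a := by
    have h1 : (k : ℝ) < m₀ := by exact_mod_cast hm₀'.1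
    rw [ha', div_lt_iff₀ (by linarith)]
    linarith [hk' m₀ hm₀'.2 hm₀'.1]
  have hafter : ∀ m ≤ n, k < m → partialSumY w m - a' * m ≤ partialSumY w k - a' * k := by
    intro m hm hkm
    have h1 : (k : ℝ) < m := by exact_mod_cast hkm
    have h2 := hmax m (Finset.mem_Ioc.2 ⟨hkm, hm⟩)
    rw [div_le_iff₀ (by linarith)] at h2
    linarith
  refine lt_of_le_of_lt ?_ ha
  refine hslope.trans ?_
  set G := leastConcaveMajorant (cumSum w)
  set ℓ : ℝ → ℝ := fun c => partialSumY w k / n - c * (k / n) with hℓ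
  have hconc : ConcaveOn ℝ (Icc 0 1) (fun u : ℝ => min (ℓ a + a * u) (ℓ a' + a' * u)) :=
    (concaveOn_affine _ _).inf (concaveOn_affine _ _)
  have hmaj := cumSum_le_of_concaveOn hn w hconc (fun m hm => by
    apply le_min
    · linarith [partialSumY_le_line hn (hk m hm)]
    · rcases le_or_gt m k with h | h
      · have h1 := partialSumY_le_line hn (hk m hm)
        have h2 : (m : ℝ) / n ≤ k / n := by gcongr
        nlinarith
      · linarith [partialSumY_le_line hn (hafter m hm h)])
  have hGi : G (i / n) ≤ ℓ a' + a' * (i / n) :=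
    (leastConcaveMajorant_le hconc hmaj (node_mem hn hin)).trans (min_le_right _ _)
  have hGk : partialSumY w k / n ≤ G (k / n) := le_lcm_node hn w (by omega)
  have hlt : (k : ℝ) / n < i / n := by gcongr
  rw [slope_comm, slope_def_field, div_le_iff₀ (by linarith)]
  simp only [hℓ] at hGi
  linarith

theorem exists_last_maximizer {n : ℕ} (w : Fin n → ℝ × ℝ) (a : ℝ) :
    ∃ k ≤ n, (∀ m ≤ n, partialSumY w m - a * m ≤ partialSumY w k - a * k) ∧
      ∀ m ≤ n, k < m → partialSumY w m - a * m < partialSumY w k - a * k := by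
  obtain ⟨k₀, hk₀, hmax⟩ := Finset.exists_max_image (Finset.range (n + 1))
    (fun m => partialSumY w m - a * m) ⟨0, by simp⟩
  obtain ⟨k, hk, hlast⟩ := Finset.exists_max_image
    ((Finset.range (n + 1)).filter fun m =>
      partialSumY w k₀ - a * k₀ ≤ partialSumY w m - a * m) id ⟨k₀, by simpa using hk₀⟩
  simp only [Finset.mem_filter, Finset.mem_range, id] at hk hlast hmax
  refine ⟨k, by omega, fun m hm => (hmax m (by omega)).trans hk.2, fun m hm hkm => ?_⟩
  by_contra! hcon
  have := hlast m ⟨by omega, hk.2.trans hcon⟩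
  omega

theorem exists_maximizer_ge_of_le_lambdaHat {n : ℕ} (hn : 0 < n) (w : Fin n → ℝ × ℝ) {a : ℝ}
    {i : ℕ} (hin : i ≤ n) (ha : a ≤ lambdaHat w (i / n)) :
    ∃ k ≤ n, i ≤ k ∧ ∀ m ≤ n, partialSumY w m - a * m ≤ partialSumY w k - a * k := by
  obtain ⟨k, hkn, hk, hk'⟩ := exists_last_maximizer w a
  refine ⟨k, hkn, ?_, hk⟩
  by_contra! hlt
  exact (lambdaHat_lt hn w hlt hin hk hk').not_ge ha

theorem exists_strict_maximizer_lt_of_lambdaHat_lt {n : ℕ} (hn : 0 < n) (w : Fin n → ℝ × ℝ)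
    {a : ℝ} {i : ℕ} (hi : 0 < i) (ha : lambdaHat w (i / n) < a) :
    ∃ k ≤ n, k < i ∧ ∀ m ≤ n, k < m → partialSumY w m - a * m < partialSumY w k - a * k := by
  obtain ⟨k, hkn, hk, hk'⟩ := exists_last_maximizer w a
  refine ⟨k, hkn, ?_, hk'⟩
  by_contra! hle
  exact (le_lambdaHat hn w hi hle hkn hk).not_gt ha

theorem lambdaHat_antitone {n : ℕ} (hn : 0 < n) (w : Fin n → ℝ × ℝ) {i j : ℕ} (hi : 0 < i)
    (hij : i ≤ j) (hj : j ≤ n) : lambdaHat w (j / n) ≤ lambdaHat w (i / n) := by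
  obtain ⟨k, hkn, hjk, hk⟩ := exists_maximizer_ge_of_le_lambdaHat hn w hj le_rfl
  exact le_lambdaHat hn w hi (hij.trans hjk) hkn hk

theorem muHat_antitone {n : ℕ} (hn : 0 < n) (w : Fin n → ℝ × ℝ) : Antitone (muHat w) := by
  intro s t hst
  have h : (Finset.univ.filter fun i => (w i).1 < s).card ≤
      (Finset.univ.filter fun i => (w i).1 < t).card :=
    Finset.card_le_card fun i => by
      simp only [Finset.mem_filter, Finset.mem_univ, true_and]
      exact fun h => h.trans_le hst
  exact lambdaHat_antitone hn w (by omega) (by omega) (by omega)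

open ProbabilityTheory

/-! ### A maximal inequality for products of independent factors -/

section Ville

variable {Ω ι : Type*} [MeasurableSpace Ω] {ν : Measure Ω}

theorem lintegral_finset_prod_le_one [IsProbabilityMeasure ν] {f : ι → Ω → ℝ≥0∞}
    (hf : ∀ i, Measurable (f i)) (hind : iIndepFun f ν) (hle : ∀ i, ∫⁻ ω, f i ω ∂ν ≤ 1)
    (T : Finset ι) : ∫⁻ ω, ∏ i ∈ T, f i ω ∂ν ≤ 1 := by
  classical
  induction T using Finset.induction_on with
  | empty => simp
  | insert a T ha ih =>
    have h := hind.indepFun_finsetProd_of_notMem hf ha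
    rw [show ∏ i ∈ T, f i = fun ω => ∏ i ∈ T, f i ω by ext ω; simp] at h
    have h' := lintegral_mul_eq_lintegral_mul_lintegral_of_indepFun
      (Finset.measurable_fun_prod T fun i _ => hf i) (hf a) h
    simp only [Finset.prod_insert ha]
    calc ∫⁻ ω, f a ω * ∏ i ∈ T, f i ω ∂ν = ∫⁻ ω, ((fun ω => ∏ i ∈ T, f i ω) * f a) ω ∂ν := by
          congr with ω; simp [mul_comm]
      _ = (∫⁻ ω, ∏ i ∈ T, f i ω ∂ν) * ∫⁻ ω, f a ω ∂ν := h'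
      _ ≤ 1 * 1 := by
          gcongr
          exact hle a
      _ = 1 := one_mul 1

open Classical in
/-- The product of the coordinates in the growing sets `S r`, stopped once it reaches `l`. -/
noncomputable def stoppedProd (S : ℕ → Finset ι) (l : ℝ≥0∞) : ℕ → (ι → ℝ≥0∞) → ℝ≥0∞
  | 0, _ => 1
  | r + 1, z => if l ≤ stoppedProd S l r z then stoppedProd S l r z
      else stoppedProd S l r z * ∏ i ∈ S (r + 1) \ S r, z i

theorem measurable_stoppedProd (S : ℕ → Finset ι) (l : ℝ≥0∞) (r : ℕ) :
    Measurable (stoppedProd S l r) := by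
  classical
  induction r with
  | zero => exact measurable_const
  | succ r ih =>
    refine Measurable.ite (measurableSet_le measurable_const ih) ih (ih.mul ?_)
    exact Finset.measurable_fun_prod _ fun i _ => measurable_pi_apply i

theorem stoppedProd_congr {S : ℕ → Finset ι} (hS : Monotone S) (l : ℝ≥0∞) (r : ℕ)
    {z z' : ι → ℝ≥0∞} (h : ∀ i ∈ S r, z i = z' i) : stoppedProd S l r z = stoppedProd S l r z' := by
  classical
  induction r with
  | zero => rfl
  | succ r ih =>
    have h1 := ih fun i hi => h i (hS (Nat.le_succ r) hi)
    simp only [stoppedProd, h1]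
    have h2 : ∏ i ∈ S (r + 1) \ S r, z i = ∏ i ∈ S (r + 1) \ S r, z' i :=
      Finset.prod_congr rfl fun i hi => h i (Finset.mem_sdiff.1 hi).1
    rw [h2]

/-- Before stopping nothing has been left out, so the stopped product exceeds `l` as soon as the
plain one does. This reduces the maximum over the chain to the single final value. -/
theorem le_stoppedProd_or_eq {S : ℕ → Finset ι} (hS : Monotone S) (hS0 : S 0 = ∅) (l : ℝ≥0∞)
    (r : ℕ) (z : ι → ℝ≥0∞) :
    l ≤ stoppedProd S l r z ∨ stoppedProd S l r z = ∏ i ∈ S r, z i := by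
  classical
  induction r with
  | zero => right; simp [stoppedProd, hS0]
  | succ r ih =>
    by_cases h : l ≤ stoppedProd S l r z
    · left; simp [stoppedProd, h]
    · right
      simp only [stoppedProd, if_neg h]
      rw [ih.resolve_left h, mul_comm]
      exact Finset.prod_sdiff (hS (Nat.le_succ r))

theorem le_stoppedProd_of_le {S : ℕ → Finset ι} {l : ℝ≥0∞} {r M : ℕ} (hrM : r ≤ M)
    {z : ι → ℝ≥0∞} (h : l ≤ stoppedProd S l r z) : l ≤ stoppedProd S l M z := by
  induction M, hrM using Nat.le_induction with
  | base => exact h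
  | succ M _ ih => simp [stoppedProd, ih]

theorem lintegral_stoppedProd_le_one [IsProbabilityMeasure ν] {f : ι → Ω → ℝ≥0∞}
    (hf : ∀ i, Measurable (f i)) (hind : iIndepFun f ν) (hle : ∀ i, ∫⁻ ω, f i ω ∂ν ≤ 1)
    {S : ℕ → Finset ι} (hS : Monotone S) (l : ℝ≥0∞) (r : ℕ) :
    ∫⁻ ω, stoppedProd S l r (fun i => f i ω) ∂ν ≤ 1 := by
  classical
  induction r with
  | zero => simp [stoppedProd]
  | succ r ih =>
    set V : Ω → ℝ≥0∞ := fun ω => stoppedProd S l r (fun i => f i ω) with hV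
    set Q : Ω → ℝ≥0∞ := fun ω => ∏ i ∈ S (r + 1) \ S r, f i ω with hQ
    have hVm : Measurable V :=
      (measurable_stoppedProd S l r).comp (measurable_pi_lambda _ fun i => hf i)
    have hQm : Measurable Q := Finset.measurable_fun_prod _ fun i _ => hf i
    have hset : MeasurableSet {ω | l ≤ V ω} := measurableSet_le measurable_const hVm
    -- Supermartingale step: `A` is the stopped part, which is frozen, and `B` the running part,
    -- which is multiplied by the new block `Q`. `B` depends only on coordinates in `S r`, so it is
    -- independent of `Q`, whose mean is at most one.
    set A : Ω → ℝ≥0∞ := fun ω => if l ≤ V ω then V ω else 0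
    set B : Ω → ℝ≥0∞ := fun ω => if l ≤ V ω then 0 else V ω
    have hAm : Measurable A := Measurable.ite hset hVm measurable_const
    have hBm : Measurable B := Measurable.ite hset measurable_const hVm
    have hindVQ : IndepFun B Q ν := by
      have h := hind.indepFun_finset (S r) (S (r + 1) \ S r) Finset.disjoint_sdiff hf
      have hm : Measurable fun z : S r → ℝ≥0∞ =>
          stoppedProd S l r (fun i => if h : i ∈ S r then z ⟨i, h⟩ else 0) := by
        refine (measurable_stoppedProd S l r).comp (measurable_pi_lambda _ fun i => ?_)
        by_cases hi : i ∈ S r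
        · simpa [hi] using measurable_pi_apply _
        · simp [hi]
      have h' := h.comp
        (φ := fun z : S r → ℝ≥0∞ =>
          if l ≤ stoppedProd S l r (fun i => if h : i ∈ S r then z ⟨i, h⟩ else 0) then 0
          else stoppedProd S l r (fun i => if h : i ∈ S r then z ⟨i, h⟩ else 0))
        (ψ := fun z : (S (r + 1) \ S r : Finset ι) → ℝ≥0∞ => ∏ i, z i)
        (Measurable.ite (measurableSet_le measurable_const hm) measurable_const hm)
        (Finset.measurable_fun_prod _ fun i _ => measurable_pi_apply i)
      have hBeq : B = (fun z : S r → ℝ≥0∞ =>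
          if l ≤ stoppedProd S l r (fun i => if h : i ∈ S r then z ⟨i, h⟩ else 0) then 0
          else stoppedProd S l r (fun i => if h : i ∈ S r then z ⟨i, h⟩ else 0)) ∘
            fun a (i : S r) => f i a := by
        funext ω
        have : V ω = stoppedProd S l r (fun i => if h : i ∈ S r then f i ω else 0) :=
          stoppedProd_congr hS l r fun i hi => by simp [hi]
        simp only [B, this, Function.comp]
      have hQeq : Q = (fun z : (S (r + 1) \ S r : Finset ι) → ℝ≥0∞ => ∏ i, z i) ∘
          fun a (i : (S (r + 1) \ S r : Finset ι)) => f i a := by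
        funext ω
        simp only [Q, Function.comp]
        exact (Finset.prod_coe_sort (S (r + 1) \ S r) fun i => f i ω).symm
      rw [hBeq, hQeq]
      exact h'
    have hBQ := lintegral_mul_eq_lintegral_mul_lintegral_of_indepFun hBm hQm hindVQ
    calc ∫⁻ ω, stoppedProd S l (r + 1) (fun i => f i ω) ∂ν
        = ∫⁻ ω, A ω + (B * Q) ω ∂ν := by
          congr with ω
          by_cases h : l ≤ V ω
          · simp only [hV] at h
            simp [stoppedProd, A, B, h, V]
          · simp only [hV] at h
            simp [stoppedProd, A, B, h, V, Q]
      _ = ∫⁻ ω, A ω ∂ν + (∫⁻ ω, B ω ∂ν) * ∫⁻ ω, Q ω ∂ν := by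
          rw [lintegral_add_left hAm, hBQ]
      _ ≤ ∫⁻ ω, A ω ∂ν + (∫⁻ ω, B ω ∂ν) * 1 := by
          gcongr
          exact lintegral_finset_prod_le_one hf hind hle _
      _ = ∫⁻ ω, V ω ∂ν := by
          rw [mul_one, ← lintegral_add_left hAm]
          congr with ω
          by_cases h : l ≤ V ω <;> simp [A, B, h]
      _ ≤ 1 := ih

/-- Ville's maximal inequality for products of independent factors of mean at most one, over
an increasing chain of index sets. -/
theorem maximal_inequality_prod [IsProbabilityMeasure ν] {f : ι → Ω → ℝ≥0∞}
    (hf : ∀ i, Measurable (f i)) (hind : iIndepFun f ν) (hle : ∀ i, ∫⁻ ω, f i ω ∂ν ≤ 1)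
    {S : ℕ → Finset ι} (hS : Monotone S) (hS0 : S 0 = ∅) (l : ℝ≥0∞) (M : ℕ) :
    l * ν {ω | ∃ r ≤ M, l ≤ ∏ i ∈ S r, f i ω} ≤ 1 := by
  have hsub : {ω | ∃ r ≤ M, l ≤ ∏ i ∈ S r, f i ω} ⊆
      {ω | l ≤ stoppedProd S l M (fun i => f i ω)} := by
    rintro ω ⟨r, hr, h⟩
    refine le_stoppedProd_of_le hr ?_
    rcases le_stoppedProd_or_eq hS hS0 l r (fun i => f i ω) with h' | h'
    · exact h'
    · rw [h']; exact h
  have hVm : Measurable fun ω => stoppedProd S l M (fun i => f i ω) :=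
    (measurable_stoppedProd S l M).comp (measurable_pi_lambda _ fun i => hf i)
  calc l * ν {ω | ∃ r ≤ M, l ≤ ∏ i ∈ S r, f i ω}
      ≤ l * ν {ω | l ≤ stoppedProd S l M (fun i => f i ω)} := by gcongr
    _ ≤ ∫⁻ ω, stoppedProd S l M (fun i => f i ω) ∂ν := mul_meas_ge_le_lintegral hVm l
    _ ≤ 1 := lintegral_stoppedProd_le_one hf hind hle hS l M

end Ville

/-! ### Removing the factor `K` for centered errors -/

section SubGaussian

theorem exp_le_one_add_add_sq_mul (u : ℝ) : Real.exp u ≤ 1 + u + u ^ 2 * Real.exp |u| := by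
  rcases le_or_gt |u| 1 with h | h
  · have h1 := (abs_le.1 (Real.abs_exp_sub_one_sub_id_le h)).2
    have h2 : 1 ≤ Real.exp |u| := Real.one_le_exp (abs_nonneg u)
    nlinarith [sq_nonneg u]
  · have h2 : Real.exp u ≤ Real.exp |u| := Real.exp_le_exp.2 (le_abs_self u)
    have h3 : 1 ≤ Real.exp |u| := Real.one_le_exp (abs_nonneg u)
    have h4 : |u| ^ 2 = u ^ 2 := sq_abs u
    rcases le_or_gt 0 u with hu | hu
    · have h6 : 1 ≤ u ^ 2 := by nlinarith
      have h7 : 0 ≤ (u ^ 2 - 1) * Real.exp |u| := mul_nonneg (by linarith) (Real.exp_pos _).le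
      linarith
    · have h5 : Real.exp u ≤ 1 := Real.exp_le_one_iff.2 hu.le
      rw [abs_of_neg hu] at h h3 ⊢
      nlinarith

/-- The linear term integrates to zero for a centered variable, and the remainder is `θ²` times
moments at the fixed exponents `±2`. -/
theorem exp_mul_le_one_add_add {θ : ℝ} (hθ : |θ| ≤ 1) (x : ℝ) :
    Real.exp (θ * x) ≤ 1 + θ * x + 2 * θ ^ 2 * (Real.exp (2 * x) + Real.exp (-2 * x)) := by
  have h1 := exp_le_one_add_add_sq_mul (θ * x)
  have h2 : Real.exp |θ * x| ≤ Real.exp |x| := by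
    rw [abs_mul]
    exact Real.exp_le_exp.2 (by nlinarith [abs_nonneg x])
  have h3 : x ^ 2 ≤ 2 * Real.exp |x| := by
    have := Real.quadratic_le_exp_of_nonneg (abs_nonneg x)
    rw [sq_abs] at this
    linarith [abs_nonneg x]
  have h4 : Real.exp |x| * Real.exp |x| ≤ Real.exp (2 * x) + Real.exp (-2 * x) := by
    rw [← Real.exp_add]
    rcases abs_cases x with ⟨h, -⟩ | ⟨h, -⟩
    · rw [h, ← two_mul]; linarith [Real.exp_pos (-2 * x)]
    · rw [h, show -x + -x = -2 * x by ring]; linarith [Real.exp_pos (2 * x)]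
  have h5 : (θ * x) ^ 2 * Real.exp |θ * x| ≤
      2 * θ ^ 2 * (Real.exp (2 * x) + Real.exp (-2 * x)) := by
    calc (θ * x) ^ 2 * Real.exp |θ * x| ≤ (θ * x) ^ 2 * Real.exp |x| := by gcongr
      _ = θ ^ 2 * (x ^ 2 * Real.exp |x|) := by ring
      _ ≤ θ ^ 2 * (2 * Real.exp |x| * Real.exp |x|) := by gcongr
      _ = 2 * θ ^ 2 * (Real.exp |x| * Real.exp |x|) := by ring
      _ ≤ _ := by gcongr
  linarith

/-- The sub-Gaussian constant of a centered variable with `E exp (θ ε) ≤ K exp (θ² α)`. -/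
noncomputable def subGaussConst (K α : ℝ) : ℝ := K + α + 4 * K * Real.exp (4 * α)

theorem subGaussConst_pos {K α : ℝ} (hK : 0 < K) (hα : 0 < α) : 0 < subGaussConst K α := by
  unfold subGaussConst; positivity

/-- A factor `K` per observation would be fatal in a product of many factors. For `|θ| ≤ 1`
centering replaces it by `1 + O(θ²)`; for `|θ| > 1` it is absorbed through `K ≤ exp (K θ²)`. -/
theorem integral_exp_le_of_centered {Ω : Type*} [MeasurableSpace Ω] {ν : Measure Ω}
    [IsProbabilityMeasure ν] {X : Ω → ℝ} {K α : ℝ} (hK : 0 < K) (hα : 0 < α) (hX : Integrable X ν)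
    (hX0 : ∫ ω, X ω ∂ν = 0) {θ : ℝ}
    (hint : ∀ t ∈ ({θ, 2, -2} : Set ℝ), Integrable (fun ω => Real.exp (t * X ω)) ν ∧
      ∫ ω, Real.exp (t * X ω) ∂ν ≤ K * Real.exp (t ^ 2 * α)) :
    ∫ ω, Real.exp (θ * X ω) ∂ν ≤ Real.exp (subGaussConst K α * θ ^ 2) := by
  obtain ⟨hi, hb⟩ := hint θ (by simp)
  obtain ⟨hi2, hb2⟩ := hint 2 (by simp)
  obtain ⟨hi2', hb2'⟩ := hint (-2) (by simp)
  have he : 0 < Real.exp (4 * α) := Real.exp_pos _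
  rcases le_or_gt |θ| 1 with hθ | hθ
  · have hg : Integrable (fun ω => 1 + θ * X ω + 2 * θ ^ 2 *
        (Real.exp (2 * X ω) + Real.exp (-2 * X ω))) ν :=
      ((integrable_const _).add (hX.const_mul _)).add ((hi2.add hi2').const_mul _)
    calc ∫ ω, Real.exp (θ * X ω) ∂ν ≤ ∫ ω, (1 + θ * X ω + 2 * θ ^ 2 *
        (Real.exp (2 * X ω) + Real.exp (-2 * X ω))) ∂ν :=
          integral_mono hi hg fun ω => exp_mul_le_one_add_add hθ _
      _ = 1 + 2 * θ ^ 2 * (∫ ω, Real.exp (2 * X ω) ∂ν + ∫ ω, Real.exp (-2 * X ω) ∂ν) := by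
          have e1 : ∫ ω, (1 + θ * X ω) ∂ν = 1 := by
            rw [integral_add (integrable_const _) (hX.const_mul _), integral_const_mul, hX0]
            simp
          have e2 : ∫ ω, 2 * θ ^ 2 * (Real.exp (2 * X ω) + Real.exp (-2 * X ω)) ∂ν = 2 * θ ^ 2 *
              (∫ ω, Real.exp (2 * X ω) ∂ν + ∫ ω, Real.exp (-2 * X ω) ∂ν) := by
            rw [integral_const_mul, integral_add hi2 hi2']
          have e3 : Integrable (fun ω => 1 + θ * X ω) ν := (integrable_const _).add (hX.const_mul _)
          have e4 : Integrable (fun ω => 2 * θ ^ 2 *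
              (Real.exp (2 * X ω) + Real.exp (-2 * X ω))) ν := (hi2.add hi2').const_mul _
          rw [integral_add e3 e4, e1, e2]
      _ ≤ 1 + 2 * θ ^ 2 * (K * Real.exp (4 * α) + K * Real.exp (4 * α)) := by
          gcongr
          · exact hb2.trans_eq (by norm_num)
          · exact hb2'.trans_eq (by norm_num)
      _ ≤ 1 + subGaussConst K α * θ ^ 2 := by
          unfold subGaussConst
          nlinarith [sq_nonneg θ, mul_nonneg (add_pos hK hα).le (sq_nonneg θ)]
      _ ≤ _ := by linarith [Real.add_one_le_exp (subGaussConst K α * θ ^ 2)]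
  · have h1 : 1 ≤ θ ^ 2 := by nlinarith [sq_abs θ, abs_nonneg θ]
    have h2 : K ≤ Real.exp (K * θ ^ 2) := by
      have := Real.add_one_le_exp (K * θ ^ 2)
      nlinarith
    calc _ ≤ K * Real.exp (θ ^ 2 * α) := hb
      _ ≤ Real.exp (K * θ ^ 2) * Real.exp (θ ^ 2 * α) := by gcongr
      _ = Real.exp ((K + α) * θ ^ 2) := by rw [← Real.exp_add]; ring_nf
      _ ≤ _ := by
        apply Real.exp_le_exp.2
        unfold subGaussConst
        have : 0 ≤ 4 * K * Real.exp (4 * α) := by positivity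
        nlinarith

end SubGaussian

/-! ### The regression model given the covariates -/

/-- The extension of a function on `[0,1]` that is constant on `(-∞,0]` and on `[1,∞)`. -/
def clampExtend (μ : ℝ → ℝ) (x : ℝ) : ℝ := μ (max 0 (min 1 x))

theorem clamp_mem (x : ℝ) : max 0 (min 1 x) ∈ Icc (0 : ℝ) 1 :=
  ⟨le_max_left _ _, max_le zero_le_one (min_le_left _ _)⟩

theorem clampExtend_of_mem (μ : ℝ → ℝ) {x : ℝ} (hx : x ∈ Icc (0 : ℝ) 1) :
    clampExtend μ x = μ x := by
  rw [clampExtend, min_eq_right hx.2, max_eq_right hx.1]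

theorem antitone_clampExtend {μ : ℝ → ℝ} (hμ : AntitoneOn μ (Icc 0 1)) :
    Antitone (clampExtend μ) := fun x y hxy =>
  hμ (clamp_mem x) (clamp_mem y) (by gcongr)

variable {c C K α : ℝ} {μ : ℝ → ℝ} {P : Measure (ℝ × ℝ)}

theorem HasBoundedDensity.ae_mem (h : HasBoundedDensity c C P) : ∀ᵐ w ∂P, w.1 ∈ Icc (0 : ℝ) 1 := by
  obtain ⟨f, -, -, hP⟩ := h
  have : ∀ᵐ x ∂(P.map Prod.fst), x ∈ Icc (0 : ℝ) 1 := by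
    rw [hP]
    exact (withDensity_absolutelyContinuous _ _).ae_le (ae_restrict_mem measurableSet_Icc)
  exact ae_of_ae_map measurable_fst.aemeasurable this

theorem IsModelLaw.ae_condDistrib (h : IsModelLaw c C K α μ P) [IsProbabilityMeasure P]
    (hμ : AntitoneOn μ (Icc 0 1)) (hK : 0 < K) (hα : 0 < α) (θ : ℝ) :
    ∀ᵐ x ∂(P.map Prod.fst), ∫⁻ y, ENNReal.ofReal
      (Real.exp (θ * (y - clampExtend μ x) - subGaussConst K α * θ ^ 2))
        ∂(condDistrib Prod.snd Prod.fst P x) ≤ 1 := by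
  -- `μ` may fail to be measurable off `[0,1]`. The extension is antitone, hence measurable, and
  -- agrees with `μ` at almost every covariate.
  set m := clampExtend μ with hm
  have hmm : Measurable m := (antitone_clampExtend hμ).measurable
  have hmem := h.hasBoundedDensity.ae_mem
  have hμm : ∀ᵐ w ∂P, μ w.1 = m w.1 := by
    filter_upwards [hmem] with w hw using (clampExtend_of_mem μ hw).symm
  have hid : P.map (fun a : ℝ × ℝ => (a.1, a.2)) = P := Measure.map_id
  set κ := condDistrib (Prod.snd : ℝ × ℝ → ℝ) Prod.fst P with hκ
  have transfer : ∀ {p : ℝ → Prop}, MeasurableSet {x | p x} → (∀ᵐ w ∂P, p w.1) →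
      ∀ᵐ x ∂(P.map Prod.fst), p x := fun hp hw =>
    (ae_map_iff measurable_fst.aemeasurable hp).2 hw
  have hYint : ∀ᵐ x ∂(P.map Prod.fst), Integrable (fun y : ℝ => y) (κ x) := by
    have : Integrable (fun w : ℝ × ℝ => w.2) (P.map fun a : ℝ × ℝ => (a.1, a.2)) := by
      rw [hid]; exact h.isRegressionFunction.1
    exact Integrable.condDistrib_ae_map (X := (Prod.fst : ℝ × ℝ → ℝ)) (Y := (Prod.snd : ℝ × ℝ → ℝ))
      measurable_snd.aemeasurable this
  have hYmean : ∀ᵐ x ∂(P.map Prod.fst), ∫ y, y ∂(κ x) = m x := by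
    have h1 := condExp_ae_eq_integral_condDistrib (μ := P) (X := (Prod.fst : ℝ × ℝ → ℝ))
      (Y := Prod.snd) measurable_fst measurable_snd.aemeasurable (f := fun y : ℝ => y)
      stronglyMeasurable_id h.isRegressionFunction.1
    refine transfer (measurableSet_eq_fun ?_ hmm) ?_
    · exact (StronglyMeasurable.integral_kernel (κ := κ) stronglyMeasurable_id).measurable
    · filter_upwards [h1, h.isRegressionFunction.2, hμm] with w e1 e2 e3
      rw [← e3, ← e2]
      exact e1.symm
  have hexp : ∀ t : ℝ, ∀ᵐ x ∂(P.map Prod.fst), Integrable (fun y => Real.exp (t * (y - m x))) (κ x) ∧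
      ∫ y, Real.exp (t * (y - m x)) ∂(κ x) ≤ K * Real.exp (t ^ 2 * α) := by
    intro t
    obtain ⟨hi, hb⟩ := h.hasLightTails t
    set F : ℝ × ℝ → ℝ := fun w => Real.exp (t * (w.2 - m w.1)) with hF
    have hFm : Measurable F := by fun_prop
    have hcongr : (fun w : ℝ × ℝ => Real.exp (t * (w.2 - μ w.1))) =ᵐ[P] F := by
      filter_upwards [hμm] with w hw
      simp only [hF, hw]
    have hFi : Integrable F P := hi.congr hcongr
    have h1 : ∀ᵐ x ∂(P.map Prod.fst), Integrable (fun y => F (x, y)) (κ x) := by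
      have : Integrable F (P.map fun a : ℝ × ℝ => (a.1, a.2)) := by rwa [hid]
      exact Integrable.condDistrib_ae_map (X := (Prod.fst : ℝ × ℝ → ℝ)) (Y := (Prod.snd : ℝ × ℝ → ℝ))
        measurable_snd.aemeasurable this
    have h2 := condExp_prod_ae_eq_integral_condDistrib (μ := P) (X := (Prod.fst : ℝ × ℝ → ℝ))
      (Y := Prod.snd) measurable_fst measurable_snd.aemeasurable hFm.stronglyMeasurable hFi
    have h3 : ∀ᵐ x ∂(P.map Prod.fst), ∫ y, F (x, y) ∂(κ x) ≤ K * Real.exp (t ^ 2 * α) := by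
      refine transfer (measurableSet_le ?_ measurable_const) ?_
      · exact (hFm.stronglyMeasurable.integral_kernel_prod_right' (κ := κ)).measurable
      · filter_upwards [h2, hb, condExp_congr_ae (m := sigmaX) hcongr] with w e1 e2 e3
        rw [← e1]
        exact e3.symm.le.trans e2
    filter_upwards [h1, h3] with x e1 e2 using ⟨e1, e2⟩
  -- Only three exponents are needed, so finitely many null sets suffice.
  filter_upwards [hYint, hYmean, hexp θ, hexp 2, hexp (-2)] with x e1 e2 e3 e4 e5
  have hX : Integrable (fun y => y - m x) (κ x) := e1.sub (integrable_const _)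
  have hX0 : ∫ y, (y - m x) ∂(κ x) = 0 := by
    rw [integral_sub e1 (integrable_const _), e2]; simp
  have hmain := integral_exp_le_of_centered hK hα hX hX0 (θ := θ) (by
    rintro t (rfl | rfl | rfl)
    · exact e3
    · exact e4
    · exact e5)
  set β := subGaussConst K α
  have hsplit : ∀ y, Real.exp (θ * (y - m x) - β * θ ^ 2) =
      Real.exp (θ * (y - m x)) * Real.exp (-(β * θ ^ 2)) := fun y => by
    rw [← Real.exp_add, sub_eq_add_neg]
  rw [← ofReal_integral_eq_lintegral_ofReal _ (Eventually.of_forall fun y => (Real.exp_pos _).le)]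
  · rw [ENNReal.ofReal_le_one]
    simp only [hsplit]
    rw [integral_mul_const]
    calc _ ≤ Real.exp (β * θ ^ 2) * Real.exp (-(β * θ ^ 2)) := by gcongr
      _ = 1 := by rw [← Real.exp_add]; simp
  · simp only [hsplit]
    exact e3.1.mul_const _

/-- The law of an observation is the law of `(x, g x u)` with independent `x` and uniform `u`. -/
theorem exists_map_prod_eq (P : Measure (ℝ × ℝ)) [IsProbabilityMeasure P] :
    ∃ g : ℝ → unitInterval → ℝ, Measurable (Function.uncurry g) ∧
      (∀ x, volume.map (g x) = condDistrib Prod.snd Prod.fst P x) ∧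
      P = ((P.map Prod.fst).prod volume).map fun z : ℝ × unitInterval => (z.1, g z.1 z.2) := by
  set κ := condDistrib (Prod.snd : ℝ × ℝ → ℝ) Prod.fst P with hκ
  obtain ⟨g, hg, hgκ⟩ := κ.exists_measurable_map_eq_unitInterval
  refine ⟨g, hg, hgκ, ?_⟩
  have : IsProbabilityMeasure (P.map Prod.fst) :=
    Measure.isProbabilityMeasure_map measurable_fst.aemeasurable
  have hT : Measurable fun z : ℝ × unitInterval => (z.1, g z.1 z.2) :=
    measurable_fst.prodMk hg
  have hP : (P.map Prod.fst) ⊗ₘ κ = P := by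
    have e : (P.map Prod.fst) ⊗ₘ κ = P.map fun a : ℝ × ℝ => (a.1, a.2) :=
      compProd_map_condDistrib measurable_snd.aemeasurable
    rw [e]
    exact Measure.map_id
  ext s hs
  conv_lhs => rw [← hP]
  rw [Measure.compProd_apply hs, Measure.map_apply hT hs, Measure.prod_apply (hT hs)]
  refine lintegral_congr fun x => ?_
  have hgx : Measurable (g x) := hg.comp measurable_prodMk_left
  rw [← hgκ x, Measure.map_apply hgx (measurable_prodMk_left hs)]
  rfl

/-- Conditioning on the whole design by Fubini: driving the responses by uniform variables
independent of the covariates makes them independent once `x` is fixed. -/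
theorem pi_apply_eq_lintegral (n : ℕ) {PX : Measure ℝ} [IsProbabilityMeasure PX]
    {g : ℝ → unitInterval → ℝ} (hg : Measurable (Function.uncurry g))
    (hP : P = (PX.prod volume).map fun z : ℝ × unitInterval => (z.1, g z.1 z.2))
    {E : Set (Fin n → ℝ × ℝ)} (hE : MeasurableSet E) :
    Measure.pi (fun _ : Fin n => P) E = ∫⁻ x, Measure.pi (fun _ : Fin n => (volume : Measure unitInterval))
      {u | (fun i => (x i, g (x i) (u i))) ∈ E} ∂(Measure.pi fun _ : Fin n => PX) := by
  have hT : Measurable fun z : ℝ × unitInterval => (z.1, g z.1 z.2) :=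
    measurable_fst.prodMk hg
  have : IsProbabilityMeasure ((PX.prod (volume : Measure unitInterval)).map
      fun z : ℝ × unitInterval => (z.1, g z.1 z.2)) :=
    Measure.isProbabilityMeasure_map hT.aemeasurable
  have h1 : Measure.pi (fun _ : Fin n => P) = (Measure.pi fun _ : Fin n =>
      PX.prod (volume : Measure unitInterval)).map fun z i => ((z i).1, g (z i).1 (z i).2) := by
    rw [hP, ← Measure.pi_map_pi (fun _ => hT.aemeasurable)]
  have hmp := measurePreserving_arrowProdEquivProdArrow ℝ unitInterval (Fin n)
    (fun _ => PX) (fun _ => volume)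
  have h2 := hmp.symm.map_eq
  have hTn : Measurable fun (z : Fin n → ℝ × unitInterval) i => ((z i).1, g (z i).1 (z i).2) :=
    measurable_pi_lambda _ fun i => hT.comp (measurable_pi_apply i)
  rw [h1, Measure.map_apply hTn hE, ← h2, Measure.map_apply (MeasurableEquiv.measurable _) (hTn hE),
    Measure.prod_apply ((MeasurableEquiv.measurable _) (hTn hE))]
  rfl

theorem measurableSet_exists_sum_ge {n : ℕ} {m : ℝ → ℝ} (hm : Measurable m) (θ b : ℝ)
    {Φ : (Fin n → ℝ) → ℝ} (hΦ : Measurable Φ) {S : (Fin n → ℝ) → ℕ → Finset (Fin n)}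
    (hS : ∀ r i, MeasurableSet {x | i ∈ S x r}) :
    MeasurableSet {w : Fin n → ℝ × ℝ | ∃ r ≤ n, Φ (fun i => (w i).1) ≤
      ∑ i ∈ S (fun i => (w i).1) r, (θ * ((w i).2 - m (w i).1) - b)} := by
  classical
  have hx : Measurable fun (w : Fin n → ℝ × ℝ) i => (w i).1 :=
    measurable_pi_lambda _ fun i => (measurable_pi_apply i).fst
  have : {w : Fin n → ℝ × ℝ | ∃ r ≤ n, Φ (fun i => (w i).1) ≤
      ∑ i ∈ S (fun i => (w i).1) r, (θ * ((w i).2 - m (w i).1) - b)} =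
      ⋃ r ∈ Finset.range (n + 1), {w | Φ (fun i => (w i).1) ≤
      ∑ i, if i ∈ S (fun i => (w i).1) r then (θ * ((w i).2 - m (w i).1) - b) else 0} := by
    ext w
    simp [Finset.sum_ite_mem]
  rw [this]
  refine Finset.measurableSet_biUnion _ fun r _ => measurableSet_le (hΦ.comp hx) ?_
  refine Finset.measurable_fun_sum _ fun i _ => Measurable.ite (hx (hS r i)) ?_ measurable_const
  fun_prop

/-- Exponential bound for the maximum of the centered sums over a chain of index sets which depends
on the covariates only. -/
theorem IsModelLaw.measure_exists_sum_ge_le (h : IsModelLaw c C K α μ P)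
    (hμ : AntitoneOn μ (Icc 0 1)) (hK : 0 < K) (hα : 0 < α) (θ : ℝ) {n : ℕ}
    {Φ : (Fin n → ℝ) → ℝ} (hΦ : Measurable Φ) {S : (Fin n → ℝ) → ℕ → Finset (Fin n)}
    (hS : ∀ r i, MeasurableSet {x | i ∈ S x r}) (hS0 : ∀ x, S x 0 = ∅)
    (hSmono : ∀ x, Monotone (S x)) :
    Measure.pi (fun _ : Fin n => P) {w | ∃ r ≤ n, Φ (fun i => (w i).1) ≤
      ∑ i ∈ S (fun i => (w i).1) r,
        (θ * ((w i).2 - clampExtend μ (w i).1) - subGaussConst K α * θ ^ 2)} ≤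
    ∫⁻ x, ENNReal.ofReal (Real.exp (-Φ x)) ∂(Measure.pi fun _ : Fin n => P.map Prod.fst) := by
  have := h.isProbabilityMeasure
  have : IsProbabilityMeasure (P.map Prod.fst) :=
    Measure.isProbabilityMeasure_map measurable_fst.aemeasurable
  set m := clampExtend μ with hm
  have hmm : Measurable m := (antitone_clampExtend hμ).measurable
  set β := subGaussConst K α
  obtain ⟨g, hg, hgκ, hP⟩ := exists_map_prod_eq P
  rw [pi_apply_eq_lintegral n hg hP (measurableSet_exists_sum_ge hmm θ (β * θ ^ 2) hΦ hS)]
  refine lintegral_mono_ae ?_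
  have hae : ∀ᵐ x ∂(Measure.pi fun _ : Fin n => P.map Prod.fst), ∀ i,
      ∫⁻ y, ENNReal.ofReal (Real.exp (θ * (y - m (x i)) - β * θ ^ 2))
        ∂(condDistrib Prod.snd Prod.fst P (x i)) ≤ 1 := by
    rw [ae_all_iff]
    intro i
    exact (Measure.tendsto_eval_ae_ae (μ := fun _ : Fin n => P.map Prod.fst) (i := i)).eventually
      (h.ae_condDistrib hμ hK hα θ)
  filter_upwards [hae] with x hx
  have hgx : ∀ i, Measurable (g (x i)) := fun i => hg.comp measurable_prodMk_left
  set φ : Fin n → unitInterval → ℝ≥0∞ := fun i u =>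
    ENNReal.ofReal (Real.exp (θ * (g (x i) u - m (x i)) - β * θ ^ 2)) with hφ
  have hφm : ∀ i, Measurable (φ i) := fun i => by
    have := hgx i
    fun_prop
  have hind := iIndepFun_pi (μ := fun _ : Fin n => (volume : Measure unitInterval)) (X := φ)
    fun i => (hφm i).aemeasurable
  have hle : ∀ i, ∫⁻ u, φ i (u i) ∂(Measure.pi fun _ : Fin n => (volume : Measure unitInterval)) ≤ 1 := by
    intro i
    have e := (measurePreserving_eval (fun _ : Fin n => (volume : Measure unitInterval)) i)
    rw [e.lintegral_comp (f := φ i) (hφm i)]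
    have e2 := hx i
    rw [← hgκ, lintegral_map (by fun_prop) (hgx i)] at e2
    exact e2
  -- With `x` fixed the chain `S x` and the level `exp (Φ x)` are deterministic.
  have hville := maximal_inequality_prod (fun i => (hφm i).comp (measurable_pi_apply i)) hind hle
    (hSmono x) (hS0 x) (ENNReal.ofReal (Real.exp (Φ x))) n
  have hset : {u : Fin n → unitInterval | ∃ r ≤ n, ENNReal.ofReal (Real.exp (Φ x)) ≤
      ∏ i ∈ S x r, φ i (u i)} = {u | (fun i => (x i, g (x i) (u i))) ∈
      {w : Fin n → ℝ × ℝ | ∃ r ≤ n, Φ (fun i => (w i).1) ≤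
      ∑ i ∈ S (fun i => (w i).1) r, (θ * ((w i).2 - m (w i).1) - β * θ ^ 2)}} := by
    ext u
    simp only [mem_ofPred_eq, hφ]
    refine exists_congr fun r => and_congr_right fun _ => ?_
    rw [← ENNReal.ofReal_prod_of_nonneg fun i _ => (Real.exp_pos _).le, ← Real.exp_sum,
      ENNReal.ofReal_le_ofReal_iff (Real.exp_pos _).le, Real.exp_le_exp]
  simp only [Function.comp_def] at hville
  rw [hset] at hville
  rw [Real.exp_neg, ENNReal.ofReal_inv_of_pos (Real.exp_pos _), ENNReal.le_inv_iff_mul_le, mul_comm]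
  exact hville

/-! ### Counting covariates in an interval -/

theorem HasBoundedDensity.measure_ge (h : HasBoundedDensity c C P) {s t : ℝ} (hs : 0 ≤ s)
    (hst : s ≤ t) (ht : t ≤ 1) : ENNReal.ofReal (c * (t - s)) ≤ P.map Prod.fst (Ico s t) := by
  obtain ⟨f, hf, hb, hP⟩ := h
  rw [hP, withDensity_apply _ measurableSet_Ico, Measure.restrict_restrict measurableSet_Ico,
    inter_eq_left.2 (Ico_subset_Icc_self.trans (Icc_subset_Icc hs ht))]
  have h0 : 0 ≤ t - s := by linarith
  calc ENNReal.ofReal (c * (t - s)) ≤ ENNReal.ofReal c * volume (Ico s t) := by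
        rw [Real.volume_Ico, ENNReal.ofReal_mul' h0]
    _ = ∫⁻ _ in Ico s t, ENNReal.ofReal c := by simp
    _ ≤ _ := setLIntegral_mono' measurableSet_Ico fun x hx => ENNReal.ofReal_le_ofReal
        (hb x ⟨hs.trans hx.1, hx.2.le.trans ht⟩).1

/-- The exponential moment of minus the number of covariates in an interval. -/
theorem HasBoundedDensity.lintegral_exp_neg_count_le [IsProbabilityMeasure P]
    (h : HasBoundedDensity c C P) (hc : 0 < c)
    {s t κ : ℝ} (hs : 0 ≤ s) (hst : s ≤ t) (ht : t ≤ 1) (hκ : 0 ≤ κ) (n : ℕ) :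
    ∫⁻ x, ENNReal.ofReal (Real.exp (-(κ * ∑ i : Fin n, (Ico s t).indicator 1 (x i))))
      ∂(Measure.pi fun _ : Fin n => P.map Prod.fst) ≤
    ENNReal.ofReal (Real.exp (-(n * (c * (t - s)) * (min 1 κ / 2)))) := by
  have : IsProbabilityMeasure (P.map Prod.fst) :=
    Measure.isProbabilityMeasure_map measurable_fst.aemeasurable
  set PX := P.map Prod.fst
  set φ : ℝ → ℝ := fun x => Real.exp (-(κ * (Ico s t).indicator 1 x)) with hφ
  have hprod : ∀ x : Fin n → ℝ, Real.exp (-(κ * ∑ i : Fin n, (Ico s t).indicator 1 (x i))) =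
      ∏ i, φ (x i) := fun x => by
    rw [hφ, ← Real.exp_sum, Finset.mul_sum, Finset.sum_neg_distrib]
  have hφm : Measurable φ := by
    have : Measurable ((Ico s t).indicator (1 : ℝ → ℝ)) :=
      measurable_one.indicator measurableSet_Ico
    fun_prop
  have hφ_eq : ∀ x, φ x = 1 - (1 - Real.exp (-κ)) * (Ico s t).indicator 1 x := fun x => by
    by_cases hx : x ∈ Ico s t <;> simp [φ, hx]
  have hone : Integrable ((Ico s t).indicator (1 : ℝ → ℝ)) PX :=
    (integrable_const 1).indicator measurableSet_Ico
  have hφi : Integrable φ PX := by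
    simp only [funext hφ_eq]
    exact (integrable_const _).sub (hone.const_mul _)
  have hint : ∫ x, φ x ∂PX = 1 - (1 - Real.exp (-κ)) * PX.real (Ico s t) := by
    simp only [hφ_eq]
    rw [integral_sub (integrable_const _) (hone.const_mul _), integral_const_mul,
      integral_indicator_one measurableSet_Ico]
    simp
  have hq : c * (t - s) ≤ PX.real (Ico s t) := by
    rw [Measure.real, ← ENNReal.ofReal_le_iff_le_toReal (measure_ne_top _ _)]
    exact h.measure_ge hs hst ht
  -- For `κ ≤ 1` this follows from `exp (-κ) ≤ 1 / (1 + κ)`, for `κ ≥ 1` from `exp (-1) < 1/2`.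
  have hmin : min 1 κ / 2 ≤ 1 - Real.exp (-κ) := by
    rcases le_total κ 1 with h1 | h1
    · rw [min_eq_right h1]
      have e1 : Real.exp (-κ) * (1 + κ) ≤ 1 := by
        rw [Real.exp_neg, inv_mul_le_one₀ (Real.exp_pos κ)]
        linarith [Real.add_one_le_exp κ]
      nlinarith
    · rw [min_eq_left h1]
      have h2 : Real.exp (-κ) ≤ Real.exp (-1) := Real.exp_le_exp.2 (by linarith)
      have := Real.exp_neg_one_lt_d9
      linarith
  have hbase : ∫ x, φ x ∂PX ≤ Real.exp (-((c * (t - s)) * (min 1 κ / 2))) := by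
    rw [hint]
    have h0 : 0 ≤ c * (t - s) := mul_nonneg hc.le (by linarith)
    have h1 : 0 ≤ min 1 κ / 2 := by positivity
    have h2 := Real.add_one_le_exp (-((c * (t - s)) * (min 1 κ / 2)))
    nlinarith
  have hnn : 0 ≤ ∫ x, φ x ∂PX := integral_nonneg fun x => (Real.exp_pos _).le
  simp only [hprod]
  rw [← ofReal_integral_eq_lintegral_ofReal (Integrable.fintype_prod fun _ => hφi)
    (Eventually.of_forall fun x => Finset.prod_nonneg fun i _ => (Real.exp_pos _).le),
    integral_fintype_prod_eq_pow]
  refine ENNReal.ofReal_le_ofReal ?_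
  rw [Fintype.card_fin]
  calc _ ≤ Real.exp (-((c * (t - s)) * (min 1 κ / 2))) ^ n := by gcongr
    _ = _ := by rw [← Real.exp_nat_mul]; ring_nf

/-! ### Ranks and windows of ordered observations -/

section Rank

variable {n : ℕ}

/-- The position of `x i` in the ordered sample, counted from `0`. -/
noncomputable def rank (x : Fin n → ℝ) (i : Fin n) : ℕ := (Tuple.sort x).symm i

/-- The indices of the observations with rank in `[l, k)`. -/
noncomputable def rankWindow (x : Fin n → ℝ) (l k : ℕ) : Finset (Fin n) :=
  Finset.univ.filter fun i => l ≤ rank x i ∧ rank x i < k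

/-- The number of covariates below `t`. -/
noncomputable def countLt (x : Fin n → ℝ) (t : ℝ) : ℕ := (Finset.univ.filter fun i => x i < t).card

theorem countLt_le (x : Fin n → ℝ) (t : ℝ) : countLt x t ≤ n :=
  (Finset.card_filter_le _ _).trans_eq (by simp)

theorem countLt_mono (x : Fin n → ℝ) {s t : ℝ} (hst : s ≤ t) : countLt x s ≤ countLt x t :=
  Finset.card_le_card fun i => by
    simp only [Finset.mem_filter, Finset.mem_univ, true_and]
    exact fun h => h.trans_le hst

/-- Translates between windows of ranks and intervals of covariates. It holds for tied samples too,
so almost sure distinctness is never invoked. -/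
theorem rank_lt_countLt_iff (x : Fin n → ℝ) (t : ℝ) (i : Fin n) :
    rank x i < countLt x t ↔ x i < t := by
  have h := Tuple.lt_card_lt_iff_apply_lt_of_monotone (j := (Tuple.sort x).symm i) (a := t)
    (Tuple.monotone_sort x)
  have hc : (Finset.univ.filter fun j => (x ∘ Tuple.sort x) j < t).card = countLt x t := by
    refine Finset.card_equiv (Tuple.sort x) fun j => ?_
    simp
  rw [hc] at h
  simpa [rank] using h

theorem sum_indicator_Ico_eq (x : Fin n → ℝ) {s t : ℝ} (hst : s ≤ t) :
    ∑ i, (Ico s t).indicator (1 : ℝ → ℝ) (x i) = (countLt x t : ℝ) - countLt x s := by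
  unfold countLt
  rw [Finset.card_filter, Finset.card_filter]
  push_cast
  rw [← Finset.sum_sub_distrib]
  refine Finset.sum_congr rfl fun i _ => ?_
  by_cases h1 : x i < s
  · simp [h1, h1.trans_le hst, h1.not_ge]
  · by_cases h2 : x i < t
    · simp [h1, h2, not_lt.1 h1]
    · simp [h1, h2]

theorem sum_rankWindow (x : Fin n → ℝ) (f : Fin n → ℝ) (l k : ℕ) :
    ∑ i ∈ rankWindow x l k, f i =
      ∑ j : Fin n, if l ≤ (j : ℕ) ∧ (j : ℕ) < k then f (Tuple.sort x j) else 0 := by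
  rw [rankWindow, Finset.sum_filter]
  refine (Equiv.sum_comp (Tuple.sort x) _).symm.trans (Finset.sum_congr rfl fun j _ => ?_)
  simp [rank]

theorem card_rankWindow (x : Fin n → ℝ) {l k : ℕ} (hlk : l ≤ k) (hk : k ≤ n) :
    ((rankWindow x l k).card : ℝ) = (k : ℝ) - l := by
  have h := sum_rankWindow x (fun _ => 1) l k
  rw [Finset.sum_const, nsmul_eq_mul, mul_one] at h
  rw [h, Fin.sum_univ_eq_sum_range (fun j => if l ≤ j ∧ j < k then (1 : ℝ) else 0) n,
    ← Finset.sum_filter]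
  have : (Finset.range n).filter (fun j => l ≤ j ∧ j < k) = Finset.Ico l k := by
    ext j; simp; omega
  rw [this]
  simp [Nat.cast_sub hlk]

theorem partialSumY_sub (w : Fin n → ℝ × ℝ) {l k : ℕ} (hlk : l ≤ k) :
    partialSumY w k - partialSumY w l = ∑ i ∈ rankWindow (fun i => (w i).1) l k, (w i).2 := by
  rw [sum_rankWindow, partialSumY, partialSumY, ← Finset.sum_sub_distrib]
  refine Finset.sum_congr rfl fun j _ => ?_
  by_cases h1 : (j : ℕ) < l
  · simp [h1, h1.trans_le hlk, h1.not_ge]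
  · by_cases h2 : (j : ℕ) < k
    · simp [h1, h2, not_lt.1 h1, orderedY]
    · simp [h1, h2]

/-- The sorting permutation is determined by finitely many comparisons: monotonicity along `σ`, with
ties broken by the index. -/
theorem measurableSet_sort_eq (σ : Equiv.Perm (Fin n)) :
    MeasurableSet {x : Fin n → ℝ | Tuple.sort x = σ} := by
  have : {x : Fin n → ℝ | Tuple.sort x = σ} =
      (⋂ i, ⋂ j, ⋂ (_ : i ≤ j), {x | x (σ i) ≤ x (σ j)}) ∩
        ⋂ i, ⋂ j, ⋂ (_ : i < j ∧ ¬ σ i < σ j), {x | x (σ i) = x (σ j)}ᶜ := by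
    ext x
    simp only [mem_inter_iff, mem_iInter, mem_compl_iff, mem_ofPred_eq]
    rw [eq_comm, Tuple.eq_sort_iff]
    refine and_congr Iff.rfl ⟨fun h i j hij he => hij.2 (h i j hij.1 he), fun h i j hij he => ?_⟩
    by_contra hn
    exact h i j ⟨hij, hn⟩ he
  rw [this]
  refine MeasurableSet.inter ?_ ?_
  · exact MeasurableSet.iInter fun i => MeasurableSet.iInter fun j => MeasurableSet.iInter fun _ =>
      measurableSet_le (measurable_pi_apply _) (measurable_pi_apply _)
  · exact MeasurableSet.iInter fun i => MeasurableSet.iInter fun j => MeasurableSet.iInter fun _ =>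
      (measurableSet_eq_fun (measurable_pi_apply (σ i)) (measurable_pi_apply (σ j))).compl

theorem measurable_rank (i : Fin n) : Measurable fun x : Fin n → ℝ => rank x i := by
  refine measurable_to_countable' fun j => ?_
  have : (fun x : Fin n → ℝ => rank x i) ⁻¹' {j} =
      ⋃ σ : Equiv.Perm (Fin n), ⋃ (_ : (σ.symm i : ℕ) = j), {x | Tuple.sort x = σ} := by
    ext x
    simp [rank]
  rw [this]
  exact MeasurableSet.iUnion fun σ => MeasurableSet.iUnion fun _ => measurableSet_sort_eq σ

theorem measurable_countLt (t : ℝ) : Measurable fun x : Fin n → ℝ => countLt x t := by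
  simp only [countLt, Finset.card_filter]
  refine Finset.measurable_fun_sum _ fun i _ => Measurable.ite ?_ measurable_const measurable_const
  exact measurableSet_lt (measurable_pi_apply i) measurable_const

theorem measurableSet_mem_rankWindow {l k : (Fin n → ℝ) → ℕ} (hl : Measurable l)
    (hk : Measurable k) (i : Fin n) : MeasurableSet {x | i ∈ rankWindow x (l x) (k x)} := by
  have : {x | i ∈ rankWindow x (l x) (k x)} = {x | l x ≤ rank x i} ∩ {x | rank x i < k x} := by
    ext x; simp [rankWindow]
  rw [this]
  exact (measurableSet_le hl (measurable_rank i)).inter (measurableSet_lt (measurable_rank i) hk)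

theorem rankWindow_mono (x : Fin n → ℝ) {l l' k k' : ℕ} (hl : l' ≤ l) (hk : k ≤ k') :
    rankWindow x l k ⊆ rankWindow x l' k' := fun i => by
  simp only [rankWindow, Finset.mem_filter, Finset.mem_univ, true_and]
  omega

theorem rankWindow_self (x : Fin n → ℝ) (l : ℕ) : rankWindow x l l = ∅ := by
  ext i
  simp [rankWindow]

end Rank

/-! ### Exponential tail bounds for the estimator -/

section Tail

variable {c C K α : ℝ} {μ : ℝ → ℝ} {P : Measure (ℝ × ℝ)} {n : ℕ}

theorem exists_sum_nonneg_of_le_muHat (hn : 0 < n) {w : Fin n → ℝ × ℝ} {a t : ℝ}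
    (h : a ≤ muHat w t) : ∃ k ≤ n, countLt (fun i => (w i).1) t ≤ k ∧ 0 < k ∧ ∀ l ≤ k,
      0 ≤ ∑ i ∈ rankWindow (fun i => (w i).1) l k, ((w i).2 - a) := by
  obtain ⟨k, hkn, hik, hk⟩ := exists_maximizer_ge_of_le_lambdaHat hn w (min_le_right _ _) h
  have hc := countLt_le (fun i => (w i).1) t
  -- The index in `muHat` is `min (countLt + 1) n`. Weakening to `countLt ≤ k` covers the truncation
  -- at `n`; `0 < k` is kept for the bound that uses a single observation.
  refine ⟨k, hkn, ?_, ?_, fun l hl => ?_⟩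
  · change (Finset.univ.filter fun i => (w i).1 < t).card ≤ k
    change (Finset.univ.filter fun i => (w i).1 < t).card ≤ n at hc
    omega
  · omega
  · have h1 := hk l (hl.trans hkn)
    rw [Finset.sum_sub_distrib, ← partialSumY_sub w hl, Finset.sum_const, nsmul_eq_mul,
      card_rankWindow _ hl hkn]
    linarith

theorem exists_sum_neg_of_muHat_lt (hn : 0 < n) {w : Fin n → ℝ × ℝ} {a t : ℝ}
    (h : muHat w t < a) : ∃ k < n, k ≤ countLt (fun i => (w i).1) t ∧ ∀ m ≤ n, k < m →
      ∑ i ∈ rankWindow (fun i => (w i).1) k m, ((w i).2 - a) < 0 := by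
  obtain ⟨k, hkn, hik, hk⟩ := exists_strict_maximizer_lt_of_lambdaHat_lt hn w (by omega) h
  have hc := countLt_le (fun i => (w i).1) t
  refine ⟨k, by omega, ?_, fun m hm hkm => ?_⟩
  · change k ≤ (Finset.univ.filter fun i => (w i).1 < t).card
    change (Finset.univ.filter fun i => (w i).1 < t).card ≤ n at hc
    omega
  · have h1 := hk m hm hkm
    rw [Finset.sum_sub_distrib, ← partialSumY_sub w hkm.le, Finset.sum_const, nsmul_eq_mul,
      card_rankWindow _ hkm.le hm]
    linarith

/-- `θ = y / (2 β)` maximizes `θ y - β θ²`, with value `y² / (4 β)` per observation. -/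
theorem card_mul_le_sum {ι : Type*} (T : Finset ι) {f : ι → ℝ} {y β : ℝ} (hβ : 0 < β) (hy : 0 < y)
    (h : T.card * y ≤ ∑ i ∈ T, f i) :
    T.card * (y ^ 2 / (4 * β)) ≤ ∑ i ∈ T, (y / (2 * β) * f i - β * (y / (2 * β)) ^ 2) := by
  rw [Finset.sum_sub_distrib, ← Finset.mul_sum, Finset.sum_const, nsmul_eq_mul]
  have h1 : y / (2 * β) * (T.card * y) ≤ y / (2 * β) * ∑ i ∈ T, f i := by gcongr
  have h2 : y / (2 * β) * (T.card * y) - T.card * (β * (y / (2 * β)) ^ 2) =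
      T.card * (y ^ 2 / (4 * β)) := by
    field_simp
    ring
  linarith

/-- The start `l x` and the guaranteed length `N x` depend on the design alone, while the end of the
block is random. The windows `[l x, l x + r)` form a chain in `r`, so the maximal inequality treats
all ends without a union bound. -/
theorem IsModelLaw.measure_le_muHat_le_lintegral (h : IsModelLaw c C K α μ P)
    (hμ : AntitoneOn μ (Icc 0 1)) (hK : 0 < K) (hα : 0 < α) (hn : 0 < n) {t a y : ℝ} (hy : 0 < y)
    {l N : (Fin n → ℝ) → ℕ} (hl : Measurable l) (hN : Measurable N)
    (hlN : ∀ x : Fin n → ℝ, ∀ k, 0 < k → countLt x t ≤ k → l x + N x ≤ k)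
    (hdrift : ∀ x i, l x ≤ rank x i → clampExtend μ (x i) ≤ a - y) :
    Measure.pi (fun _ : Fin n => P) {w | a ≤ muHat w t} ≤
      ∫⁻ x, ENNReal.ofReal (Real.exp (-(y ^ 2 / (4 * subGaussConst K α) * N x)))
        ∂(Measure.pi fun _ : Fin n => P.map Prod.fst) := by
  set β := subGaussConst K α
  have hβ : 0 < β := subGaussConst_pos hK hα
  refine le_trans (measure_mono ?_) (h.measure_exists_sum_ge_le hμ hK hα (y / (2 * β))
    (Φ := fun x => y ^ 2 / (4 * β) * N x) (S := fun x r => rankWindow x (l x) (l x + r))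
    (measurable_const.mul (measurable_from_top.comp hN))
    (fun r i => measurableSet_mem_rankWindow hl (hl.add_const r) i)
    (fun x => rankWindow_self x _)
    (fun x r r' hr => rankWindow_mono x le_rfl (by omega)))
  intro w hw
  obtain ⟨k, hkn, hck, hk0, hk⟩ := exists_sum_nonneg_of_le_muHat hn hw
  set x : Fin n → ℝ := fun i => (w i).1 with hx
  have hlk := hlN x k hk0 hck
  refine ⟨k - l x, by omega, ?_⟩
  have hlk' : l x ≤ k := by omega
  have e : l x + (k - l x) = k := by omega
  change _ ≤ ∑ i ∈ rankWindow x (l x) (l x + (k - l x)),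
    (y / (2 * β) * ((w i).2 - clampExtend μ (w i).1) - β * (y / (2 * β)) ^ 2)
  rw [e]
  have hcard := card_rankWindow x hlk' hkn
  have hsum : (rankWindow x (l x) k).card * y ≤
      ∑ i ∈ rankWindow x (l x) k, ((w i).2 - clampExtend μ (w i).1) := by
    have h1 := hk (l x) hlk'
    rw [← nsmul_eq_mul, ← Finset.sum_const]
    have h2 : ∑ i ∈ rankWindow x (l x) k, (((w i).2 - a) + y) ≤
        ∑ i ∈ rankWindow x (l x) k, ((w i).2 - clampExtend μ (w i).1) := by
      refine Finset.sum_le_sum fun i hi => ?_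
      have := hdrift x i (Finset.mem_filter.1 hi).2.1
      simp only [hx] at this
      linarith
    rw [Finset.sum_add_distrib] at h2
    linarith
  refine le_trans ?_ (card_mul_le_sum _ hβ hy hsum)
  rw [mul_comm]
  have h3 : (N x : ℝ) ≤ (rankWindow x (l x) k).card := by
    rw [hcard]
    have : ((l x + N x : ℕ) : ℝ) ≤ k := by exact_mod_cast hlk
    push_cast at this
    linarith
  gcongr

theorem IsModelLaw.measure_muHat_lt_le_lintegral (h : IsModelLaw c C K α μ P)
    (hμ : AntitoneOn μ (Icc 0 1)) (hK : 0 < K) (hα : 0 < α) (hn : 0 < n) {t a y : ℝ} (hy : 0 < y)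
    {m N : (Fin n → ℝ) → ℕ} (hm : Measurable m) (hN : Measurable N) (hmn : ∀ x, m x ≤ n)
    (hmN : ∀ x : Fin n → ℝ, ∀ k < n, k ≤ countLt x t → k + N x ≤ m x)
    (hdrift : ∀ x i, rank x i < m x → a + y ≤ clampExtend μ (x i)) :
    Measure.pi (fun _ : Fin n => P) {w | muHat w t < a} ≤
      ∫⁻ x, ENNReal.ofReal (Real.exp (-(y ^ 2 / (4 * subGaussConst K α) * N x)))
        ∂(Measure.pi fun _ : Fin n => P.map Prod.fst) := by
  set β := subGaussConst K α
  have hβ : 0 < β := subGaussConst_pos hK hα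
  refine le_trans (measure_mono ?_) (h.measure_exists_sum_ge_le hμ hK hα (-(y / (2 * β)))
    -- Mirror image of the upper tail: the right end is fixed, the windows grow to the left, and `θ`
    -- is negative.
    (Φ := fun x => y ^ 2 / (4 * β) * N x) (S := fun x r => rankWindow x (m x - r) (m x))
    (measurable_const.mul (measurable_from_top.comp hN))
    (fun r i => measurableSet_mem_rankWindow
      ((measurable_from_top (f := fun j : ℕ => j - r)).comp hm) hm i)
    (fun x => rankWindow_self x _)
    (fun x r r' hr => rankWindow_mono x (by omega) le_rfl))
  intro w hw
  obtain ⟨k, hkn, hck, hk⟩ := exists_sum_neg_of_muHat_lt hn hw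
  set x : Fin n → ℝ := fun i => (w i).1 with hx
  have hkm := hmN x k hkn hck
  have hmn' := hmn x
  refine ⟨m x - k, by omega, ?_⟩
  have e : m x - (m x - k) = k := by omega
  change _ ≤ ∑ i ∈ rankWindow x (m x - (m x - k)) (m x),
    (-(y / (2 * β)) * ((w i).2 - clampExtend μ (w i).1) - β * (-(y / (2 * β))) ^ 2)
  rw [e]
  have hcard := card_rankWindow x (show k ≤ m x by omega) hmn'
  have hsum : (rankWindow x k (m x)).card * y ≤
      ∑ i ∈ rankWindow x k (m x), -((w i).2 - clampExtend μ (w i).1) := by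
    rw [← nsmul_eq_mul, ← Finset.sum_const]
    have h1 : ∑ i ∈ rankWindow x k (m x), ((w i).2 - a) ≤ 0 := by
      rcases (show k ≤ m x by omega).eq_or_lt with h0 | h0
      · rw [← h0, rankWindow_self]; simp
      · exact (hk (m x) hmn' h0).le
    -- The term `2 (Y - a)` is chosen so that each summand reduces to the drift bound; the sum of `Y
    -- - a` is nonpositive by `h1`.
    have h2 : ∑ i ∈ rankWindow x k (m x), (y + ((w i).2 - a)) ≤
        ∑ i ∈ rankWindow x k (m x), (-((w i).2 - clampExtend μ (w i).1) + 2 * ((w i).2 - a)) := by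
      refine Finset.sum_le_sum fun i hi => ?_
      have := hdrift x i (Finset.mem_filter.1 hi).2.2
      simp only [hx] at this
      linarith
    rw [Finset.sum_add_distrib, Finset.sum_add_distrib, ← Finset.mul_sum] at h2
    linarith
  refine le_trans ?_ ((card_mul_le_sum _ hβ hy hsum).trans_eq
    (Finset.sum_congr rfl fun i _ => by ring))
  rw [mul_comm]
  have h3 : (N x : ℝ) ≤ (rankWindow x k (m x)).card := by
    rw [hcard]
    have : ((k + N x : ℕ) : ℝ) ≤ m x := by exact_mod_cast hkm
    push_cast at this
    linarith
  gcongr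

theorem IsModelLaw.lintegral_exp_neg_count_le (h : IsModelLaw c C K α μ P) (hc : 0 < c)
    {s t κ : ℝ} (hs : 0 ≤ s) (hst : s ≤ t) (ht : t ≤ 1) (hκ : 0 ≤ κ) (n : ℕ) :
    ∫⁻ x, ENNReal.ofReal (Real.exp (-(κ * ((countLt x t - countLt x s : ℕ) : ℝ))))
      ∂(Measure.pi fun _ : Fin n => P.map Prod.fst) ≤
    ENNReal.ofReal (Real.exp (-(n * (c * (t - s)) * (min 1 κ / 2)))) := by
  have := h.isProbabilityMeasure
  have h1 := h.hasBoundedDensity.lintegral_exp_neg_count_le hc hs hst ht hκ n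
  simp only [sum_indicator_Ico_eq _ hst] at h1
  simp only [Nat.cast_sub (countLt_mono _ hst)]
  exact h1

/-- Probability that the estimator at `t` exceeds a level which lies by `y` above the
regression function on `[s,1]`, where `s ≤ t`. -/
theorem IsModelLaw.measure_le_muHat_le (h : IsModelLaw c C K α μ P)
    (hμ : AntitoneOn μ (Icc 0 1)) (hc : 0 < c) (hK : 0 < K) (hα : 0 < α) (hn : 0 < n)
    {s t a y : ℝ} (hs : 0 ≤ s) (hst : s ≤ t) (ht : t ≤ 1) (hy : 0 < y)
    (ha : ∀ v ∈ Icc s 1, μ v ≤ a - y) :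
    Measure.pi (fun _ : Fin n => P) {w | a ≤ muHat w t} ≤
      ENNReal.ofReal (Real.exp (-(n * (c * (t - s)) *
        (min 1 (y ^ 2 / (4 * subGaussConst K α)) / 2)))) := by
  have hβ : 0 < subGaussConst K α := subGaussConst_pos hK hα
  refine (h.measure_le_muHat_le_lintegral hμ hK hα hn hy (l := fun x => countLt x s)
    (N := fun x => countLt x t - countLt x s) (measurable_countLt s)
    ((measurable_countLt t).sub (measurable_countLt s)) (fun x k _ hk => ?_)
    (fun x i hi => ?_)).trans (h.lintegral_exp_neg_count_le hc hs hst ht (by positivity) n)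
  · have := countLt_mono x hst
    omega
  · have h1 : s ≤ x i := by
      rw [← not_lt, ← rank_lt_countLt_iff]
      omega
    exact ha _ ⟨le_max_of_le_right (le_min (hst.trans ht) h1), (clamp_mem _).2⟩

/-- Probability that the estimator at `t` is below a level which lies by `y` below the
regression function on `[0,s]`, where `t ≤ s`. -/
theorem IsModelLaw.measure_muHat_lt_le (h : IsModelLaw c C K α μ P)
    (hμ : AntitoneOn μ (Icc 0 1)) (hc : 0 < c) (hK : 0 < K) (hα : 0 < α) (hn : 0 < n)
    {s t a y : ℝ} (ht : 0 ≤ t) (hts : t ≤ s) (hs : s ≤ 1) (hy : 0 < y)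
    (ha : ∀ v ∈ Icc 0 s, a + y ≤ μ v) :
    Measure.pi (fun _ : Fin n => P) {w | muHat w t < a} ≤
      ENNReal.ofReal (Real.exp (-(n * (c * (s - t)) *
        (min 1 (y ^ 2 / (4 * subGaussConst K α)) / 2)))) := by
  have hβ : 0 < subGaussConst K α := subGaussConst_pos hK hα
  refine (h.measure_muHat_lt_le_lintegral hμ hK hα hn hy (m := fun x => countLt x s)
    (N := fun x => countLt x s - countLt x t) (measurable_countLt s)
    ((measurable_countLt s).sub (measurable_countLt t)) (fun x => countLt_le x s)
    (fun x k _ hk => ?_)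
    (fun x i hi => ?_)).trans (h.lintegral_exp_neg_count_le hc ht hts hs (by positivity) n)
  · have := countLt_mono x hts
    omega
  · rw [rank_lt_countLt_iff] at hi
    exact ha _ ⟨(clamp_mem _).1, max_le (ht.trans hts) (min_le_of_right_le hi.le)⟩

/-- When the gap `y` holds on all of `[0,1]`, the block can start at rank `0`, and it contains at
least one observation. The bound does not improve with `n` but keeps decaying in `y`. -/
theorem IsModelLaw.measure_le_muHat_le_of_forall (h : IsModelLaw c C K α μ P)
    (hμ : AntitoneOn μ (Icc 0 1)) (hK : 0 < K) (hα : 0 < α) (hn : 0 < n)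
    {t a y : ℝ} (hy : 0 < y) (ha : ∀ v ∈ Icc (0 : ℝ) 1, μ v ≤ a - y) :
    Measure.pi (fun _ : Fin n => P) {w | a ≤ muHat w t} ≤
      ENNReal.ofReal (Real.exp (-(y ^ 2 / (4 * subGaussConst K α)))) := by
  have := h.isProbabilityMeasure
  have : IsProbabilityMeasure (P.map Prod.fst) :=
    Measure.isProbabilityMeasure_map measurable_fst.aemeasurable
  refine (h.measure_le_muHat_le_lintegral hμ hK hα hn hy (l := fun _ => 0)
    (N := fun _ => 1) measurable_const measurable_const (fun x k hk _ => by omega)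
    (fun x i _ => ha _ (clamp_mem _))).trans ?_
  simp

theorem IsModelLaw.measure_muHat_lt_le_of_forall (h : IsModelLaw c C K α μ P)
    (hμ : AntitoneOn μ (Icc 0 1)) (hK : 0 < K) (hα : 0 < α) (hn : 0 < n)
    {t a y : ℝ} (hy : 0 < y) (ha : ∀ v ∈ Icc (0 : ℝ) 1, a + y ≤ μ v) :
    Measure.pi (fun _ : Fin n => P) {w | muHat w t < a} ≤
      ENNReal.ofReal (Real.exp (-(y ^ 2 / (4 * subGaussConst K α)))) := by
  have := h.isProbabilityMeasure
  have : IsProbabilityMeasure (P.map Prod.fst) :=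
    Measure.isProbabilityMeasure_map measurable_fst.aemeasurable
  refine (h.measure_muHat_lt_le_lintegral hμ hK hα hn hy (m := fun _ => n)
    (N := fun _ => 1) measurable_const measurable_const (fun _ => le_rfl)
    (fun x k hk _ => by omega) (fun x i _ => ha _ (clamp_mem _))).trans ?_
  simp

end Tail

/-! ### Increments of functions in the class -/

section MonoClass

variable {A₁ A₂ A₃ : ℝ} {μ : ℝ → ℝ}

theorem monoClass_increment_bounds (hμ : μ ∈ monoClass A₁ A₂ A₃) {u v : ℝ} (hu : u ∈ Icc (0 : ℝ) 1)
    (hv : v ∈ Icc (0 : ℝ) 1) (huv : u ≤ v) :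
    A₁ * (v - u) ≤ μ u - μ v ∧ μ u - μ v ≤ A₂ * (v - u) := by
  obtain ⟨hanti, hdiff, hder, -⟩ := hμ
  have hd : DifferentiableOn ℝ μ (interior (Icc 0 1)) := hdiff.mono interior_subset
  have hderiv : ∀ t ∈ interior (Icc (0 : ℝ) 1), deriv μ t ≤ -A₁ ∧ -A₂ ≤ deriv μ t := by
    intro t ht
    have htI := interior_subset ht
    have h1 : derivWithin μ (Icc 0 1) t = deriv μ t :=
      derivWithin_of_mem_nhds (mem_interior_iff_mem_nhds.1 ht)
    have h2 : derivWithin μ (Icc 0 1) t ≤ 0 := hanti.derivWithin_nonpos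
    have h3 := hder t htI
    rw [abs_of_nonpos h2, h1] at h3
    constructor <;> linarith
  have h1 := (convex_Icc (0 : ℝ) 1).image_sub_le_mul_sub_of_deriv_le hdiff.continuousOn hd
    (fun t ht => (hderiv t ht).1) u hu v hv huv
  have h2 := (convex_Icc (0 : ℝ) 1).mul_sub_le_image_sub_of_le_deriv hdiff.continuousOn hd
    (fun t ht => (hderiv t ht).2) u hu v hv huv
  constructor <;> linarith

end MonoClass

/-! ### The generalized inverse -/

section GenInv

theorem genInv_mem (h : ℝ → ℝ) (a : ℝ) : genInv h a ∈ Icc (0 : ℝ) 1 :=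
  ⟨Real.sSup_nonneg fun _ ht => ht.1.1, Real.sSup_le (fun _ ht => ht.1.2) zero_le_one⟩

theorem lt_of_genInv_lt {h : ℝ → ℝ} {a v : ℝ} (hv : v ∈ Icc (0 : ℝ) 1) (hlt : genInv h a < v) :
    h v < a := by
  by_contra! hle
  exact hlt.not_ge (le_csSup ⟨1, fun _ ht => ht.1.2⟩ ⟨hv, hle⟩)

theorem exists_ge_of_lt_genInv {h : ℝ → ℝ} {a v : ℝ} (hv : 0 ≤ v) (hlt : v < genInv h a) :
    ∃ t ∈ Icc (0 : ℝ) 1, v < t ∧ a ≤ h t := by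
  -- An empty set would give the default value `0`, which cannot exceed `v ≥ 0`.
  have hne : {t : ℝ | t ∈ Icc (0 : ℝ) 1 ∧ a ≤ h t}.Nonempty := by
    by_contra hne
    rw [not_nonempty_iff_eq_empty] at hne
    rw [genInv, hne, Real.sSup_empty] at hlt
    linarith
  obtain ⟨t, ⟨ht, hat⟩, hvt⟩ := exists_lt_of_lt_csSup hne hlt
  exact ⟨t, ht, hvt, hat⟩

end GenInv

/-! ### Moments from tails on the scale `n ^ (-1/3)` -/

section LayerCake

theorem lintegral_rpow_le_tsum {Ω : Type*} [MeasurableSpace Ω] (Q : Measure Ω) {Z : Ω → ℝ}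
    (hZ : ∀ ω, 0 ≤ Z ω) {r p : ℝ} (hr : 0 < r) (hp : 0 ≤ p) :
    ∫⁻ ω, ENNReal.ofReal (Z ω ^ p) ∂Q ≤ ENNReal.ofReal (r ^ p) *
      ∑' k : ℕ, ENNReal.ofReal (((k : ℝ) + 1) ^ p) * Q {ω | (k : ℝ) * r ≤ Z ω} := by
  -- Measurable hulls of the tail events make measurability of `Z`, and so of the estimator,
  -- unnecessary.
  set T : ℕ → Set Ω := fun k => toMeasurable Q {ω | (k : ℝ) * r ≤ Z ω} with hT
  have hTm : ∀ k, MeasurableSet (T k) := fun k => measurableSet_toMeasurable _ _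
  set G : ℕ → Ω → ℝ≥0∞ := fun k =>
    (T k).indicator fun _ => ENNReal.ofReal (((k : ℝ) + 1) ^ p) with hG
  have hGm : ∀ k, Measurable (G k) := fun k => measurable_const.indicator (hTm k)
  have hpt : ∀ ω, ENNReal.ofReal (Z ω ^ p) ≤ ENNReal.ofReal (r ^ p) * ∑' k, G k ω := by
    intro ω
    set k := ⌊Z ω / r⌋₊ with hk
    have h0 : 0 ≤ Z ω / r := div_nonneg (hZ ω) hr.le
    have h1 : (k : ℝ) * r ≤ Z ω := (le_div_iff₀ hr).1 (Nat.floor_le h0)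
    have h2 : Z ω ≤ r * ((k : ℝ) + 1) := by
      have := (div_lt_iff₀ hr).1 (Nat.lt_floor_add_one (Z ω / r))
      linarith
    have h3 : Z ω ^ p ≤ r ^ p * ((k : ℝ) + 1) ^ p := by
      rw [← Real.mul_rpow hr.le (by positivity)]
      exact Real.rpow_le_rpow (hZ ω) h2 hp
    have hkT : ω ∈ T k := subset_toMeasurable Q {ω | (k : ℝ) * r ≤ Z ω} h1
    have h4 : G k ω = ENNReal.ofReal (((k : ℝ) + 1) ^ p) := indicator_of_mem hkT _
    calc ENNReal.ofReal (Z ω ^ p) ≤ ENNReal.ofReal (r ^ p * ((k : ℝ) + 1) ^ p) :=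
          ENNReal.ofReal_le_ofReal h3
      _ = ENNReal.ofReal (r ^ p) * G k ω := by
          rw [ENNReal.ofReal_mul (by positivity), h4]
      _ ≤ _ := by
          gcongr
          exact ENNReal.le_tsum k
  calc ∫⁻ ω, ENNReal.ofReal (Z ω ^ p) ∂Q ≤ ∫⁻ ω, ENNReal.ofReal (r ^ p) * ∑' k, G k ω ∂Q :=
        lintegral_mono hpt
    _ = ENNReal.ofReal (r ^ p) * ∑' k, ∫⁻ ω, G k ω ∂Q := by
        rw [lintegral_const_mul _ (Measurable.tsum hGm),
          lintegral_tsum fun k => (hGm k).aemeasurable]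
    _ = _ := by
        congr 2
        funext k
        rw [hG, lintegral_indicator_const (hTm k), hT, measure_toMeasurable]

/-- The series that bounds the risks. -/
noncomputable def tailSeries (p b : ℝ) : ℝ≥0∞ :=
  ∑' k : ℕ, ENNReal.ofReal (((k : ℝ) + 1) ^ p) * ENNReal.ofReal (2 * Real.exp (-(b * k)))

theorem tailSeries_ne_top (p : ℝ) {b : ℝ} (hb : 0 < b) : tailSeries p b ≠ ⊤ := by
  have h1 : Summable fun k : ℕ => ((k : ℝ) ^ ⌈p⌉₊) * Real.exp (-b * k) :=
    Real.summable_pow_mul_exp_neg_nat_mul _ hb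
  have h2 := ((summable_nat_add_iff 1).2 h1).mul_left (2 * Real.exp b)
  refine ne_top_of_le_ne_top (b := ∑' k : ℕ, ENNReal.ofReal (2 * Real.exp b *
    ((((k + 1 : ℕ) : ℝ) ^ ⌈p⌉₊) * Real.exp (-b * (k + 1 : ℕ))))) ?_ ?_
  · exact h2.tsum_ofReal_ne_top
  · refine ENNReal.tsum_le_tsum fun k => ?_
    rw [← ENNReal.ofReal_mul (by positivity)]
    refine ENNReal.ofReal_le_ofReal ?_
    have h3 : ((k : ℝ) + 1) ^ p ≤ ((k : ℝ) + 1) ^ ⌈p⌉₊ := by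
      rw [← Real.rpow_natCast]
      exact Real.rpow_le_rpow_of_exponent_le (by linarith [Nat.cast_nonneg (α := ℝ) k])
        (Nat.le_ceil p)
    have h4 : Real.exp b * Real.exp (-b * ((k : ℝ) + 1)) = Real.exp (-(b * k)) := by
      rw [← Real.exp_add]; ring_nf
    calc ((k : ℝ) + 1) ^ p * (2 * Real.exp (-(b * k)))
        ≤ ((k : ℝ) + 1) ^ ⌈p⌉₊ * (2 * Real.exp (-(b * k))) := by gcongr
      _ = _ := by rw [← h4]; push_cast; ring

/-- The scale `n ^ (-1/3)`. -/
noncomputable def cubeScale (n : ℕ) : ℝ := (n : ℝ) ^ (-(1 / 3) : ℝ)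

theorem cubeScale_pos {n : ℕ} (hn : 0 < n) : 0 < cubeScale n :=
  Real.rpow_pos_of_pos (by exact_mod_cast hn) _

theorem cubeScale_le_one {n : ℕ} (hn : 0 < n) : cubeScale n ≤ 1 :=
  Real.rpow_le_one_of_one_le_of_nonpos (by exact_mod_cast hn) (by norm_num)

theorem mul_cubeScale_pow {n : ℕ} (hn : 0 < n) : (n : ℝ) * cubeScale n ^ 3 = 1 := by
  have hn' : (0 : ℝ) < n := by exact_mod_cast hn
  rw [cubeScale, ← Real.rpow_natCast, ← Real.rpow_mul hn'.le]
  norm_num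
  rw [Real.rpow_neg_one]
  field_simp

theorem rpow_mul_cubeScale_rpow {n : ℕ} (hn : 0 < n) (p : ℝ) :
    (n : ℝ) ^ (p / 3) * cubeScale n ^ p = 1 := by
  have hn' : (0 : ℝ) < n := by exact_mod_cast hn
  rw [cubeScale, ← Real.rpow_mul hn'.le, ← Real.rpow_add hn']
  ring_nf
  exact Real.rpow_zero _

theorem rpow_mul_lintegral_le {Ω : Type*} [MeasurableSpace Ω] (Q : Measure Ω) {Z : Ω → ℝ}
    (hZ : ∀ ω, 0 ≤ Z ω) {p : ℝ} (hp : 0 ≤ p) {n : ℕ} (hn : 0 < n) :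
    ENNReal.ofReal ((n : ℝ) ^ (p / 3)) * ∫⁻ ω, ENNReal.ofReal (Z ω ^ p) ∂Q ≤
      ∑' k : ℕ, ENNReal.ofReal (((k : ℝ) + 1) ^ p) * Q {ω | (k : ℝ) * cubeScale n ≤ Z ω} := by
  have h := lintegral_rpow_le_tsum Q hZ (cubeScale_pos hn) hp
  calc _ ≤ ENNReal.ofReal ((n : ℝ) ^ (p / 3)) * (ENNReal.ofReal (cubeScale n ^ p) * _) :=
        mul_le_mul_right h _
    _ = _ := by
        rw [← mul_assoc, ← ENNReal.ofReal_mul (by positivity), rpow_mul_cubeScale_rpow hn]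
        simp

end LayerCake

/-! ### Risk of the inverse estimator -/

section Inverse

variable {A₁ A₂ A₃ c C K α : ℝ} {μ : ℝ → ℝ} {P : Measure (ℝ × ℝ)} {n : ℕ}

/-- An error `x` puts the estimator on the wrong side of `a` at distance `x/2` from `genInv μ a`.
The window of length `x/4` between distances `x/4` and `x/2` supplies the observations. -/
theorem IsModelLaw.measure_genInv_ge (h : IsModelLaw c C K α μ P) (hμ : μ ∈ monoClass A₁ A₂ A₃)
    (hA₁ : 0 < A₁) (hc : 0 < c) (hK : 0 < K) (hα : 0 < α) (hn : 0 < n) (a : ℝ) {x : ℝ}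
    (hx : 0 < x) :
    Measure.pi (fun _ : Fin n => P) {w | x ≤ |genInv (muHat w) a - genInv μ a|} ≤
      2 * ENNReal.ofReal (Real.exp (-(n * (c * (x / 4)) *
        (min 1 ((A₁ * x / 8) ^ 2 / (4 * subGaussConst K α)) / 2)))) := by
  set t₀ := genInv μ a with ht₀
  have ht₀m := genInv_mem μ a
  set b := ENNReal.ofReal (Real.exp (-(n * (c * (x / 4)) *
        (min 1 ((A₁ * x / 8) ^ 2 / (4 * subGaussConst K α)) / 2))))
  have hy : 0 < A₁ * x / 8 := by positivity
  have hup : Measure.pi (fun _ : Fin n => P) {w | t₀ + x / 2 < genInv (muHat w) a} ≤ b := by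
    rcases le_or_gt (t₀ + x / 2) 1 with h1 | h1
    · refine le_trans (measure_mono ?_) ((h.measure_le_muHat_le hμ.1 hc hK hα hn
        (s := t₀ + x / 4) (t := t₀ + x / 2) (a := a) (y := A₁ * x / 8) (by linarith [ht₀m.1])
        (by linarith) h1 hy ?_).trans_eq ?_)
      · intro w hw
        obtain ⟨t, ht, hlt, hat⟩ := exists_ge_of_lt_genInv (by linarith [ht₀m.1]) hw
        exact hat.trans (muHat_antitone hn w hlt.le)
      · intro v hv
        -- `μ < a` is known only strictly to the right of `t₀`, whether or not `a` is a value of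
        -- `μ`. From `t₀ + x/8` to `t₀ + x/4` the function then drops by at least `A₁ x / 8`.
        have hv' : t₀ + x / 8 ∈ Icc (0 : ℝ) 1 := ⟨by linarith [ht₀m.1], by linarith⟩
        have h2 := lt_of_genInv_lt (h := μ) (a := a) hv' (by rw [← ht₀]; linarith)
        have h3 := (monoClass_increment_bounds hμ hv' ⟨by linarith [hv.1, ht₀m.1], hv.2⟩
          (by linarith [hv.1])).1
        nlinarith [hv.1]
      · rw [show t₀ + x / 2 - (t₀ + x / 4) = x / 4 by ring]
    · have : {w : Fin n → ℝ × ℝ | t₀ + x / 2 < genInv (muHat w) a} = ∅ := by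
        ext w
        simp only [mem_ofPred_eq, mem_empty_iff_false, iff_false, not_lt]
        exact (genInv_mem _ _).2.trans h1.le
      rw [this, measure_empty]; exact zero_le
  have hdown : Measure.pi (fun _ : Fin n => P) {w | genInv (muHat w) a < t₀ - x / 2} ≤ b := by
    rcases le_or_gt 0 (t₀ - x / 2) with h1 | h1
    · refine le_trans (measure_mono ?_) ((h.measure_muHat_lt_le hμ.1 hc hK hα hn
        (s := t₀ - x / 4) (t := t₀ - x / 2) (a := a) (y := A₁ * x / 8) h1
        (by linarith) (by linarith [ht₀m.2]) hy ?_).trans_eq ?_)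
      · intro w hw
        exact lt_of_genInv_lt ⟨h1, by linarith [ht₀m.2]⟩ hw
      · intro v hv
        have hv' : t₀ - x / 8 ∈ Icc (0 : ℝ) 1 := ⟨by linarith, by linarith [ht₀m.2]⟩
        obtain ⟨t, ht, hlt, hat⟩ := exists_ge_of_lt_genInv (h := μ) (a := a) hv'.1
          (by rw [← ht₀]; linarith)
        have h2 := hμ.1 hv' ht hlt.le
        have h3 := (monoClass_increment_bounds hμ ⟨hv.1, by linarith [hv.2, ht₀m.2]⟩ hv'
          (by linarith [hv.2])).1
        nlinarith [hv.2]
      · rw [show t₀ - x / 4 - (t₀ - x / 2) = x / 4 by ring]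
    · have : {w : Fin n → ℝ × ℝ | genInv (muHat w) a < t₀ - x / 2} = ∅ := by
        ext w
        simp only [mem_ofPred_eq, mem_empty_iff_false, iff_false, not_lt]
        exact h1.le.trans (genInv_mem _ _).1
      rw [this, measure_empty]; exact zero_le
  calc _ ≤ Measure.pi (fun _ : Fin n => P) ({w | t₀ + x / 2 < genInv (muHat w) a} ∪
        {w | genInv (muHat w) a < t₀ - x / 2}) := by
        refine measure_mono fun w hw => ?_
        rcases le_abs.1 (show x ≤ |genInv (muHat w) a - t₀| from hw) with h1 | h1
        · exact Or.inl (show t₀ + x / 2 < genInv (muHat w) a by linarith)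
        · exact Or.inr (show genInv (muHat w) a < t₀ - x / 2 by linarith)
    _ ≤ b + b := (measure_union_le _ _).trans (add_le_add hup hdown)
    _ = 2 * b := (two_mul b).symm

/-- The rate in the exponential tail bound for the generalized inverse. -/
noncomputable def inverseRate (A₁ c K α : ℝ) : ℝ :=
  c * min 1 (A₁ ^ 2 / (256 * subGaussConst K α)) / 8

theorem inverseRate_pos (hA₁ : 0 < A₁) (hc : 0 < c) (hK : 0 < K) (hα : 0 < α) :
    0 < inverseRate A₁ c K α := by
  have := subGaussConst_pos hK hα
  unfold inverseRate
  positivity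

theorem IsModelLaw.inverseRisk_le (h : IsModelLaw c C K α μ P) (hμ : μ ∈ monoClass A₁ A₂ A₃)
    (hA₁ : 0 < A₁) (hc : 0 < c) (hK : 0 < K) (hα : 0 < α) (hn : 0 < n) (a : ℝ) {p : ℝ}
    (hp : 0 ≤ p) :
    ENNReal.ofReal ((n : ℝ) ^ (p / 3)) * inverseRisk n p a μ P ≤
      tailSeries p (inverseRate A₁ c K α) := by
  have := h.isProbabilityMeasure
  have hβ := subGaussConst_pos hK hα
  refine (rpow_mul_lintegral_le _ (fun w => abs_nonneg _) hp hn).trans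
    (ENNReal.tsum_le_tsum fun k => mul_le_mul_right ?_ _)
  rcases Nat.eq_zero_or_pos k with rfl | hk
  · refine prob_le_one.trans ?_
    simp
  have hk1 : (1 : ℝ) ≤ k := by exact_mod_cast hk
  set x := (k : ℝ) * cubeScale n with hx
  have hx0 : 0 < x := mul_pos (by linarith) (cubeScale_pos hn)
  rcases le_or_gt x 1 with hx1 | hx1
  · refine (h.measure_genInv_ge hμ hA₁ hc hK hα hn a hx0).trans ?_
    rw [ENNReal.ofReal_mul zero_le_two, ENNReal.ofReal_ofNat]
    gcongr 2 * ENNReal.ofReal (Real.exp (-?_))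
    -- As `x ≤ 1`, the factor `x²` can be taken out of the minimum, which makes the exponent cubic
    -- in `x`. Errors above `1` are impossible.
    have h1 : min 1 (A₁ ^ 2 / (256 * subGaussConst K α)) * x ^ 2 ≤
        min 1 ((A₁ * x / 8) ^ 2 / (4 * subGaussConst K α)) := by
      apply le_min
      · have : min 1 (A₁ ^ 2 / (256 * subGaussConst K α)) ≤ 1 := min_le_left _ _
        have h2 : x ^ 2 ≤ 1 := pow_le_one₀ hx0.le hx1
        have h3 : 0 ≤ min 1 (A₁ ^ 2 / (256 * subGaussConst K α)) := by positivity
        nlinarith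
      · calc _ ≤ A₁ ^ 2 / (256 * subGaussConst K α) * x ^ 2 := by gcongr; exact min_le_right _ _
          _ = _ := by field_simp; ring
    have h2 : (n : ℝ) * x ^ 3 = k ^ 3 := by
      rw [hx, mul_pow, mul_left_comm, mul_cubeScale_pow hn, mul_one]
    have h3 : (k : ℝ) ≤ k ^ 3 := le_self_pow₀ hk1 (by norm_num)
    calc inverseRate A₁ c K α * k ≤ inverseRate A₁ c K α * (n * x ^ 3) := by
          rw [h2]
          gcongr
          exact (inverseRate_pos hA₁ hc hK hα).le
      _ = n * (c * (x / 4)) * (min 1 (A₁ ^ 2 / (256 * subGaussConst K α)) * x ^ 2 / 2) := by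
          unfold inverseRate; ring
      _ ≤ _ := by gcongr
  · have : {w : Fin n → ℝ × ℝ | x ≤ |genInv (muHat w) a - genInv μ a|} = ∅ := by
      ext w
      simp only [mem_ofPred_eq, mem_empty_iff_false, iff_false, not_le]
      refine lt_of_le_of_lt ?_ hx1
      have h1 := genInv_mem (muHat w) a
      have h2 := genInv_mem μ a
      rw [abs_le]
      constructor <;> linarith [h1.1, h1.2, h2.1, h2.2]
    rw [this, measure_empty]; exact zero_le

end Inverse

/-! ### Risk of the estimator at a point -/

section Direct

variable {A₁ A₂ A₃ c C K α : ℝ} {μ : ℝ → ℝ} {P : Measure (ℝ × ℝ)} {n : ℕ}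

theorem measure_abs_muHat_sub_ge_le {t y : ℝ} (hy : 0 < y) {b : ℝ≥0∞}
    (hup : Measure.pi (fun _ : Fin n => P) {w | μ t + y ≤ muHat w t} ≤ b)
    (hdown : Measure.pi (fun _ : Fin n => P) {w | muHat w t < μ t - y / 2} ≤ b) :
    Measure.pi (fun _ : Fin n => P) {w | y ≤ |muHat w t - μ t|} ≤ 2 * b := by
  calc _ ≤ Measure.pi (fun _ : Fin n => P) ({w | μ t + y ≤ muHat w t} ∪
        {w | muHat w t < μ t - y / 2}) := by
        refine measure_mono fun w hw => ?_
        rcases le_abs.1 (show y ≤ |muHat w t - μ t| from hw) with h1 | h1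
        · exact Or.inl (show μ t + y ≤ muHat w t by linarith)
        · exact Or.inr (show muHat w t < μ t - y / 2 by linarith)
    _ ≤ b + b := (measure_union_le _ _).trans (add_le_add hup hdown)
    _ = 2 * b := (two_mul b).symm

theorem IsModelLaw.measure_muHat_sub_ge (h : IsModelLaw c C K α μ P) (hμ : μ ∈ monoClass A₁ A₂ A₃)
    (hA₂ : 0 < A₂) (hc : 0 < c) (hK : 0 < K) (hα : 0 < α) (hn : 0 < n) {t y : ℝ}
    (ht : t ∈ Ioo (0 : ℝ) 1) (hy : 0 < y) :
    Measure.pi (fun _ : Fin n => P) {w | y ≤ |muHat w t - μ t|} ≤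
      2 * ENNReal.ofReal (Real.exp (-(n * (c * min (y / (4 * A₂)) (min t (1 - t))) *
        (min 1 ((y / 4) ^ 2 / (4 * subGaussConst K α)) / 2)))) := by
  -- On a window of length `η` next to `t` the function moves by at most `y/4`, and the window stays
  -- in `[0,1]`. The lower tail, at level `μ t - y/2`, is what forces the gap `y/4`.
  set η := min (y / (4 * A₂)) (min t (1 - t)) with hη
  have hη0 : 0 ≤ η := le_min (by positivity) (le_min ht.1.le (by linarith [ht.2]))
  have hηt : η ≤ t := (min_le_right _ _).trans (min_le_left _ _)
  have hηt' : η ≤ 1 - t := (min_le_right _ _).trans (min_le_right _ _)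
  have hηy : A₂ * η ≤ y / 4 := by
    calc A₂ * η ≤ A₂ * (y / (4 * A₂)) := by gcongr; exact min_le_left _ _
      _ = y / 4 := by field_simp
  have htI : t ∈ Icc (0 : ℝ) 1 := Ioo_subset_Icc_self ht
  refine measure_abs_muHat_sub_ge_le hy ?_ ?_
  · refine (h.measure_le_muHat_le hμ.1 hc hK hα hn (s := t - η) (y := y / 4) (by linarith)
      (by linarith) htI.2 (by linarith) ?_).trans_eq (by rw [sub_sub_cancel])
    intro v hv
    have hvI : v ∈ Icc (0 : ℝ) 1 := ⟨by linarith [hv.1], hv.2⟩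
    rcases le_total v t with hvt | hvt
    · have := (monoClass_increment_bounds hμ hvI htI hvt).2
      nlinarith [hv.1]
    · linarith [hμ.1 htI hvI hvt]
  · refine (h.measure_muHat_lt_le hμ.1 hc hK hα hn (s := t + η) (y := y / 4) htI.1
      (by linarith) (by linarith) (by linarith) ?_).trans_eq (by rw [add_sub_cancel_left])
    intro v hv
    have hvI : v ∈ Icc (0 : ℝ) 1 := ⟨hv.1, by linarith [hv.2]⟩
    rcases le_total v t with hvt | hvt
    · linarith [hμ.1 hvI htI hvt]
    · have := (monoClass_increment_bounds hμ htI hvI hvt).2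
      nlinarith [hv.2]

theorem IsModelLaw.measure_muHat_sub_ge_of_large (h : IsModelLaw c C K α μ P)
    (hμ : μ ∈ monoClass A₁ A₂ A₃) (hK : 0 < K) (hα : 0 < α) (hn : 0 < n) {t y : ℝ}
    (ht : t ∈ Ioo (0 : ℝ) 1) (hy : 0 < y) (hyA : 8 * A₃ ≤ y) :
    Measure.pi (fun _ : Fin n => P) {w | y ≤ |muHat w t - μ t|} ≤
      2 * ENNReal.ofReal (Real.exp (-((y / 4) ^ 2 / (4 * subGaussConst K α)))) := by
  have h1 := abs_le.1 (hμ.2.2.2 t (Ioo_subset_Icc_self ht))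
  refine measure_abs_muHat_sub_ge_le hy ?_ ?_
  · refine h.measure_le_muHat_le_of_forall hμ.1 hK hα hn (by linarith) fun v hv => ?_
    have h2 := abs_le.1 (hμ.2.2.2 v hv)
    linarith [h1.1, h2.2]
  · refine h.measure_muHat_lt_le_of_forall hμ.1 hK hα hn (by linarith) fun v hv => ?_
    have h2 := abs_le.1 (hμ.2.2.2 v hv)
    linarith [h1.2, h2.1]

/-- The rate in the exponential tail bound for the estimator at a point. -/
noncomputable def directRate (A₂ c K α : ℝ) : ℝ :=
  min (c / (512 * A₂ * subGaussConst K α)) (min (c / (8 * A₂)) (1 / (64 * subGaussConst K α)))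

theorem directRate_pos (hA₂ : 0 < A₂) (hc : 0 < c) (hK : 0 < K) (hα : 0 < α) :
    0 < directRate A₂ c K α := by
  have := subGaussConst_pos hK hα
  unfold directRate
  positivity

/-- The rate at which the design near the point `t` becomes rich enough. -/
noncomputable def localRate (A₂ c K α t : ℝ) : ℝ :=
  c * min t (1 - t) * (min 1 ((A₂ * min t (1 - t)) ^ 2 / (4 * subGaussConst K α)) / 2)

theorem localRate_pos (hA₂ : 0 < A₂) (hc : 0 < c) (hK : 0 < K) (hα : 0 < α) {t : ℝ}
    (ht : t ∈ Ioo (0 : ℝ) 1) : 0 < localRate A₂ c K α t := by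
  have := subGaussConst_pos hK hα
  have h1 : 0 < min t (1 - t) := lt_min ht.1 (by linarith [ht.2])
  unfold localRate
  positivity

/-- The alternative is whether `y / (4 A₂)` fits between `t` and the end points. If it fits, the
rate is free of `t`, which is what makes `K_p` independent of `t`; if not, the exponent is linear in
`n`. -/
theorem directRate_or_localRate_le (hA₂ : 0 < A₂) (hc : 0 < c) (hK : 0 < K) (hα : 0 < α)
    (hn : 0 < n) {t : ℝ} (ht : t ∈ Ioo (0 : ℝ) 1) {k : ℕ} (hk : 0 < k) {y : ℝ}
    (hy : y = k * cubeScale n) :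
    directRate A₂ c K α * k ≤ n * (c * min (y / (4 * A₂)) (min t (1 - t))) *
        (min 1 ((y / 4) ^ 2 / (4 * subGaussConst K α)) / 2) ∨
    localRate A₂ c K α t * n ≤ n * (c * min (y / (4 * A₂)) (min t (1 - t))) *
        (min 1 ((y / 4) ^ 2 / (4 * subGaussConst K α)) / 2) := by
  have hβ := subGaussConst_pos hK hα
  set β := subGaussConst K α with hβdef
  have hk1 : (1 : ℝ) ≤ k := by exact_mod_cast hk
  have hr := cubeScale_pos hn
  have hr1 := cubeScale_le_one hn
  have hnr := mul_cubeScale_pow hn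
  have hy0 : 0 < y := by rw [hy]; positivity
  have hn0 : (0 : ℝ) < n := by exact_mod_cast hn
  rcases le_total (y / (4 * A₂)) (min t (1 - t)) with h1 | h1
  · left
    rw [min_eq_left h1]
    rcases le_total ((y / 4) ^ 2 / (4 * β)) 1 with h2 | h2
    · rw [min_eq_right h2]
      have e : n * (c * (y / (4 * A₂))) * ((y / 4) ^ 2 / (4 * β) / 2) =
          c / (512 * A₂ * β) * (n * y ^ 3) := by
        field_simp; ring
      have e2 : (n : ℝ) * y ^ 3 = k ^ 3 := by
        rw [hy, mul_pow, mul_left_comm, hnr, mul_one]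
      rw [e, e2]
      have h3 : (k : ℝ) ≤ k ^ 3 := le_self_pow₀ hk1 (by norm_num)
      gcongr
      exact min_le_left _ _
    · rw [min_eq_left h2]
      have h3 : (k : ℝ) ≤ n * y := by
        rw [hy]
        have h4 : cubeScale n ^ 3 ≤ cubeScale n := pow_le_of_le_one hr.le hr1 (by norm_num)
        have h5 : (1 : ℝ) ≤ n * cubeScale n := by
          rw [← hnr]; gcongr
        nlinarith
      calc directRate A₂ c K α * k ≤ c / (8 * A₂) * (n * y) := by
            gcongr
            exact (min_le_right _ _).trans (min_le_left _ _)
        _ = _ := by field_simp; ring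
  · right
    have hτ : 0 < min t (1 - t) := lt_min ht.1 (by linarith [ht.2])
    rw [min_eq_right h1]
    set τ := min t (1 - t) with hτdef
    have h2 : A₂ * τ ≤ y / 4 := by
      calc A₂ * τ ≤ A₂ * (y / (4 * A₂)) := by gcongr
        _ = y / 4 := by field_simp
    calc localRate A₂ c K α t * n = n * (c * τ) * (min 1 ((A₂ * τ) ^ 2 / (4 * β)) / 2) := by
          unfold localRate; rw [← hτdef, ← hβdef]; ring
      _ ≤ _ := by gcongr

theorem IsModelLaw.measure_tail_le (h : IsModelLaw c C K α μ P) (hμ : μ ∈ monoClass A₁ A₂ A₃)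
    (hA₂ : 0 < A₂) (hc : 0 < c) (hK : 0 < K) (hα : 0 < α) (hn : 0 < n)
    (hnA : (8 * A₃) ^ 2 ≤ n) {t : ℝ} (ht : t ∈ Ioo (0 : ℝ) 1) (k : ℕ) :
    Measure.pi (fun _ : Fin n => P) {w | (k : ℝ) * cubeScale n ≤ |muHat w t - μ t|} ≤
      ENNReal.ofReal (2 * Real.exp (-(directRate A₂ c K α * k))) +
      ENNReal.ofReal (Real.exp (-(localRate A₂ c K α t / 2 * n))) *
        ENNReal.ofReal (2 * Real.exp (-(localRate A₂ c K α t / 2 * k))) := by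
  have := h.isProbabilityMeasure
  have hβ := subGaussConst_pos hK hα
  have hloc := localRate_pos hA₂ hc hK hα ht
  rcases Nat.eq_zero_or_pos k with rfl | hk
  · refine prob_le_one.trans ?_
    refine le_add_of_le_of_nonneg ?_ zero_le
    simp
  have hk1 : (1 : ℝ) ≤ k := by exact_mod_cast hk
  have hr := cubeScale_pos hn
  set y := (k : ℝ) * cubeScale n with hy
  have hy0 : 0 < y := by positivity
  have hn0 : (0 : ℝ) < n := by exact_mod_cast hn
  have two_mul_ofReal : ∀ z : ℝ, 2 * ENNReal.ofReal (Real.exp z) =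
      ENNReal.ofReal (2 * Real.exp z) := fun z => by
    rw [ENNReal.ofReal_mul zero_le_two, ENNReal.ofReal_ofNat]
  rcases le_or_gt k n with hkn | hkn
  · refine (h.measure_muHat_sub_ge hμ hA₂ hc hK hα hn ht hy0).trans ?_
    rcases directRate_or_localRate_le hA₂ hc hK hα hn ht hk hy with h1 | h1
    · refine le_add_of_le_of_nonneg ?_ zero_le
      rw [two_mul_ofReal]
      gcongr
    · refine le_add_of_nonneg_of_le zero_le ?_
      rw [two_mul_ofReal, ← ENNReal.ofReal_mul (Real.exp_pos _).le, mul_left_comm (Real.exp _) 2,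
        ← Real.exp_add]
      -- Since `k ≤ n`, half of the exponent is traded for decay in `k`, and the other half remains
      -- as a factor vanishing with `n`.
      refine ENNReal.ofReal_le_ofReal ?_
      have hkn' : (k : ℝ) ≤ n := by exact_mod_cast hkn
      gcongr
      nlinarith
  · have hkn' : (n : ℝ) ≤ k := by exact_mod_cast hkn.le
    -- For `k > n`, `n * cubeScale n ^ 3 = 1` gives `y² ≥ k`. Together with `hnA` this puts `y`
    -- above `8 A₃`, where the whole-sample bound applies.
    have hyk : (k : ℝ) ≤ y ^ 2 := by
      have h1 : cubeScale n ^ 3 ≤ cubeScale n ^ 2 :=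
        pow_le_pow_of_le_one hr.le (cubeScale_le_one hn) (by norm_num)
      have h2 : (1 : ℝ) ≤ k * cubeScale n ^ 2 := by
        rw [← mul_cubeScale_pow hn]; gcongr
      rw [hy, mul_pow]
      nlinarith
    have hyA : 8 * A₃ ≤ y := by
      refine le_of_sq_le_sq ?_ hy0.le
      linarith
    refine (h.measure_muHat_sub_ge_of_large hμ hK hα hn ht hy0 hyA).trans ?_
    refine le_add_of_le_of_nonneg ?_ zero_le
    rw [two_mul_ofReal]
    gcongr
    calc directRate A₂ c K α * k ≤ 1 / (64 * subGaussConst K α) * y ^ 2 := by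
          gcongr
          exact (min_le_right _ _).trans (min_le_right _ _)
      _ = _ := by field_simp; ring

theorem IsModelLaw.directRisk_le (h : IsModelLaw c C K α μ P) (hμ : μ ∈ monoClass A₁ A₂ A₃)
    (hA₂ : 0 < A₂) (hc : 0 < c) (hK : 0 < K) (hα : 0 < α) (hn : 0 < n)
    (hnA : (8 * A₃) ^ 2 ≤ n) {t : ℝ} (ht : t ∈ Ioo (0 : ℝ) 1) {p : ℝ} (hp : 0 ≤ p) :
    ENNReal.ofReal ((n : ℝ) ^ (p / 3)) * directRisk n p t μ P ≤
      tailSeries p (directRate A₂ c K α) +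
      ENNReal.ofReal (Real.exp (-(localRate A₂ c K α t / 2 * n))) *
        tailSeries p (localRate A₂ c K α t / 2) := by
  refine (rpow_mul_lintegral_le _ (fun w => abs_nonneg _) hp hn).trans ?_
  unfold tailSeries
  rw [← ENNReal.tsum_mul_left, ← ENNReal.tsum_add]
  refine ENNReal.tsum_le_tsum fun k => ?_
  rw [mul_left_comm, ← mul_add]
  exact mul_le_mul_right (h.measure_tail_le hμ hA₂ hc hK hα hn hnA ht k) _

theorem tendsto_localTerm (hA₂ : 0 < A₂) (hc : 0 < c) (hK : 0 < K) (hα : 0 < α) {t : ℝ}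
    (ht : t ∈ Ioo (0 : ℝ) 1) (p : ℝ) :
    Tendsto (fun n : ℕ => ENNReal.ofReal (Real.exp (-(localRate A₂ c K α t / 2 * n))) *
        tailSeries p (localRate A₂ c K α t / 2)) atTop (𝓝 0) := by
  have hloc : 0 < localRate A₂ c K α t / 2 := half_pos (localRate_pos hA₂ hc hK hα ht)
  have h1 : Tendsto (fun n : ℕ => Real.exp (-(localRate A₂ c K α t / 2 * n))) atTop (𝓝 0) :=
    Real.tendsto_exp_neg_atTop_nhds_zero.comp
      (tendsto_natCast_atTop_atTop.const_mul_atTop hloc)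
  have h2 := ENNReal.tendsto_ofReal h1
  rw [ENNReal.ofReal_zero] at h2
  simpa using ENNReal.Tendsto.mul_const h2 (Or.inr (tailSeries_ne_top p hloc))

end Direct

end IsoReg

theorem corollary4p2
    (A₁ A₂ A₃ c C K α p : ℝ) (hA₁ : 0 < A₁) (hA₂ : 0 < A₂) (hA₃ : 0 < A₃)
    (hc : 0 < c) (hC : 0 < C) (hK : 0 < K) (hα : 0 < α) (hp : 1 ≤ p) :
    ∃ Kp : ℝ, 0 < Kp ∧
      ∀ P : (ℝ → ℝ) → Measure (ℝ × ℝ),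
        (∀ μ ∈ IsoReg.monoClass A₁ A₂ A₃, IsoReg.IsModelLaw c C K α μ (P μ)) →
        (∀ a : ℝ,
          limsup (fun n : ℕ => ⨆ μ ∈ IsoReg.monoClass A₁ A₂ A₃,
            ENNReal.ofReal ((n : ℝ) ^ (p / 3)) * IsoReg.inverseRisk n p a μ (P μ)) atTop
            ≤ ENNReal.ofReal Kp) ∧
        (∀ t ∈ Ioo (0 : ℝ) 1,
          limsup (fun n : ℕ => ⨆ μ ∈ IsoReg.monoClass A₁ A₂ A₃,
            ENNReal.ofReal ((n : ℝ) ^ (p / 3)) * IsoReg.directRisk n p t μ (P μ)) atTop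
            ≤ ENNReal.ofReal Kp) := by
  have hp0 : 0 ≤ p := by linarith
  set S₁ := IsoReg.tailSeries p (IsoReg.inverseRate A₁ c K α) with hS₁
  set S₂ := IsoReg.tailSeries p (IsoReg.directRate A₂ c K α) with hS₂
  have h₁ : S₁ ≠ ⊤ := IsoReg.tailSeries_ne_top p (IsoReg.inverseRate_pos hA₁ hc hK hα)
  have h₂ : S₂ ≠ ⊤ := IsoReg.tailSeries_ne_top p (IsoReg.directRate_pos hA₂ hc hK hα)
  have hS : ENNReal.ofReal (S₁.toReal + S₂.toReal + 1) = S₁ + S₂ + 1 := by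
    rw [ENNReal.ofReal_add (by positivity) zero_le_one, ENNReal.ofReal_add (by positivity)
      (by positivity), ENNReal.ofReal_toReal h₁, ENNReal.ofReal_toReal h₂, ENNReal.ofReal_one]
  -- The summand `1` absorbs the `t`-dependent local term, which is eventually at most `1` from an
  -- index that does not depend on `μ`.
  refine ⟨S₁.toReal + S₂.toReal + 1, by positivity, fun P hP => ⟨fun a => ?_, fun t ht => ?_⟩⟩
  · refine limsup_le_of_le (h := ?_)
    filter_upwards [eventually_gt_atTop 0] with n hn
    refine iSup₂_le fun μ hμ => ?_
    refine ((hP μ hμ).inverseRisk_le hμ hA₁ hc hK hα hn a hp0).trans ?_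
    rw [hS, add_assoc]
    exact le_self_add
  · refine limsup_le_of_le (h := ?_)
    filter_upwards [eventually_gt_atTop 0, eventually_ge_atTop ⌈(8 * A₃) ^ 2⌉₊,
      (IsoReg.tendsto_localTerm hA₂ hc hK hα ht p).eventually_le_const zero_lt_one] with n hn hnA hloc
    refine iSup₂_le fun μ hμ => ?_
    refine ((hP μ hμ).directRisk_le hμ hA₂ hc hK hα hn (Nat.ceil_le.1 hnA) ht hp0).trans ?_
    rw [hS, add_assoc]
    exact (add_le_add le_rfl hloc).trans le_add_self
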